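/- Let $0 \to A \to E \to B \to 0$ be an extension of $C^*$-algebras (so $A$ is, up to isomorphism, a closed two-sided ideal of $E$ with $B \cong E/A$; no algebra is assumed to be unital), and assume that $E$ is $\sigma$-unital, i.e. that $E$ has a countable approximate unit. For a unital $C^*$-algebra $D$, let the real rank $\mathrm{rr}(D) \in \{0,1,2,\ldots,\infty\}$ be the smallest integer $n \geq 0$ such that the self-adjoint $(n+1)$-tuples that generate $D$ as a left ideal are dense in $D_{\mathrm{sa}}^{n+1}$ (and $\infty$ if there is no such $n$). For a $C^*$-algebra $D$, let $M(D)$ denote its multiplier algebra and $M(D)/D$ its corona algebra. (1) If $\mathrm{rr}(M(A)) = 0$, then $$\mathrm{rr}(M(B)) \leq \mathrm{rr}(M(E)) \leq \mathrm{rr}(M(B)) + 1.$$ (2) If $\mathrm{rr}(M(A)/A) = 0$, then $$\mathrm{rr}(M(B)/B) \leq \mathrm{rr}(M(E)/E) \leq \mathrm{rr}(M(B)/B) + 1.$$ -/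

import Mathlib

open Filter Topology
open scoped MultiplierAlgebra

/-! ### Real rank -/

/-- A finite tuple in a unital ring is *unimodular* if it generates the ring as a left ideal
(for a noncommutative ring, `Ideal` means left ideal). -/
def IsUnimodularTuple {R : Type*} [Ring R] {n : ℕ} (a : Fin n → R) : Prop :=
  Ideal.span (Set.range a) = ⊤

/-- The unimodular self-adjoint `(n+1)`-tuples are dense in the space of all self-adjoint
`(n+1)`-tuples (for the norm topology). -/
def HasDenseUnimodularTuples (A : Type*) [CStarAlgebra A] (n : ℕ) : Prop :=
  Dense {a : Fin (n + 1) → selfAdjoint A | IsUnimodularTuple fun i => (a i : A)}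

/-- The *real rank* of a unital C⋆-algebra: the smallest `n ≥ 0` such that the unimodular
self-adjoint `(n+1)`-tuples are dense in the self-adjoint `(n+1)`-tuples, and `∞` if there is no
such `n`. -/
noncomputable def realRank (A : Type*) [CStarAlgebra A] : ℕ∞ :=
  ⨅ (n : ℕ) (_ : HasDenseUnimodularTuples A n), (n : ℕ∞)

/-! ### σ-unital C⋆-algebras and extensions -/

/-- A C⋆-algebra is *σ-unital* if it has a countable approximate unit: a sequence of positive
contractions `u n` (positive means of the form `star b * b`) with `u n * x → x` and `x * u n → x`
for all `x`. -/
def IsSigmaUnital (A : Type*) [NonUnitalCStarAlgebra A] : Prop :=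
  ∃ u : ℕ → A, (∀ n, ∃ b : A, u n = star b * b) ∧ (∀ n, ‖u n‖ ≤ 1) ∧
    (∀ x : A, Tendsto (fun n => u n * x) atTop (𝓝 x)) ∧
    (∀ x : A, Tendsto (fun n => x * u n) atTop (𝓝 x))

/-- `0 → A → E → B → 0`, with maps `ι` and `π`, is a (short exact) extension of C⋆-algebras. -/
structure IsCStarExtension {A E B : Type*} [NonUnitalCStarAlgebra A] [NonUnitalCStarAlgebra E]
    [NonUnitalCStarAlgebra B] (ι : A →⋆ₙₐ[ℂ] E) (π : E →⋆ₙₐ[ℂ] B) : Prop where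
  injective : Function.Injective ι
  exact : Function.Exact ι π
  surjective : Function.Surjective π

/-! ### Corona algebras -/

/-- The image of `A` in its multiplier algebra `M(A) = 𝓜(ℂ, A)`, as an ideal. -/
noncomputable def multiplierIdeal (A : Type*) [NonUnitalCStarAlgebra A] : Ideal 𝓜(ℂ, A) where
  carrier := Set.range (DoubleCentralizer.coeHom : A →⋆ₙₐ[ℂ] 𝓜(ℂ, A))
  zero_mem' := ⟨0, map_zero _⟩
  add_mem' := by
    rintro _ _ ⟨a, rfl⟩ ⟨b, rfl⟩
    exact ⟨a + b, map_add _ _ _⟩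
  smul_mem' := by
    rintro m _ ⟨a, rfl⟩
    refine ⟨m.fst a, ?_⟩
    apply DoubleCentralizer.ext
    refine Prod.ext (ContinuousLinearMap.ext fun y => ?_) (ContinuousLinearMap.ext fun y => ?_)
    · change m.fst a * y = m.fst (a * y)
      have key : ∀ z : A, z * (m.fst a * y) = z * m.fst (a * y) := fun z => by
        rw [← mul_assoc, ← m.central, ← m.central, mul_assoc]
      have h := key (star (m.fst a * y - m.fst (a * y)))
      rw [← sub_eq_zero, ← mul_sub, CStarRing.star_mul_self_eq_zero_iff, sub_eq_zero] at h
      exact h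
    · change y * m.fst a = m.snd y * a
      exact (m.central y a).symm

theorem mem_multiplierIdeal {A : Type*} [NonUnitalCStarAlgebra A] {m : 𝓜(ℂ, A)} :
    m ∈ multiplierIdeal A ↔ ∃ a : A, (a : 𝓜(ℂ, A)) = m := Iff.rfl

theorem star_mem_multiplierIdeal {A : Type*} [NonUnitalCStarAlgebra A] {m : 𝓜(ℂ, A)}
    (hm : m ∈ multiplierIdeal A) : star m ∈ multiplierIdeal A := by
  obtain ⟨a, rfl⟩ := hm
  exact ⟨star a, map_star _ a⟩

instance multiplierIdeal_isTwoSided (A : Type*) [NonUnitalCStarAlgebra A] :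
    (multiplierIdeal A).IsTwoSided where
  mul_mem_of_left {x} y hx := by
    have h := star_mem_multiplierIdeal
      ((multiplierIdeal A).mul_mem_left (star y) (star_mem_multiplierIdeal hx))
    rwa [star_mul, star_star, star_star] at h

theorem norm_coe_multiplier {A : Type*} [NonUnitalCStarAlgebra A] (a : A) :
    ‖(a : 𝓜(ℂ, A))‖ = ‖a‖ := by
  rw [← DoubleCentralizer.norm_fst, DoubleCentralizer.coe_fst,
    ContinuousLinearMap.opNorm_mul_apply]

instance multiplierIdeal_isClosed (A : Type*) [NonUnitalCStarAlgebra A] :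
    IsClosed (multiplierIdeal A : Set 𝓜(ℂ, A)) := by
  have h : Isometry (DoubleCentralizer.coeHom : A →⋆ₙₐ[ℂ] 𝓜(ℂ, A)) :=
    AddMonoidHomClass.isometry_of_norm _ norm_coe_multiplier
  exact h.isClosedEmbedding.isClosed_range

/-- The *corona algebra* `M(A)/A`. It is given its quotient ⋆-algebra structure and the quotient
norm, and is shown to be a unital C⋆-algebra below. -/
def Corona (A : Type*) [NonUnitalCStarAlgebra A] : Type _ := 𝓜(ℂ, A) ⧸ multiplierIdeal A

namespace Corona

variable (A : Type*) [NonUnitalCStarAlgebra A]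

noncomputable instance instRing : Ring (Corona A) :=
  inferInstanceAs (Ring (𝓜(ℂ, A) ⧸ multiplierIdeal A))

noncomputable instance instAlgebra : Algebra ℂ (Corona A) :=
  inferInstanceAs (Algebra ℂ (𝓜(ℂ, A) ⧸ multiplierIdeal A))

/-- The quotient map `M(A) → M(A)/A`. -/
noncomputable def mk : 𝓜(ℂ, A) →ₐ[ℂ] Corona A := Ideal.Quotient.mkₐ ℂ (multiplierIdeal A)

variable {A}

theorem mk_surjective : Function.Surjective (mk A) := Ideal.Quotient.mk_surjective

theorem mk_eq_mk_iff {x y : 𝓜(ℂ, A)} : mk A x = mk A y ↔ x - y ∈ multiplierIdeal A :=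
  Ideal.Quotient.eq

/-- The involution on the corona algebra, `(mk x)⋆ = mk (x⋆)`. -/
noncomputable instance instStarRing : StarRing (Corona A) where
  star := Quotient.lift (fun x : 𝓜(ℂ, A) => mk A (star x)) (by
    intro x y h
    have h' : mk A x = mk A y := Quotient.sound h
    rw [mk_eq_mk_iff] at h' ⊢
    rw [← star_sub]
    exact star_mem_multiplierIdeal h')
  star_involutive x := by
    obtain ⟨x, rfl⟩ := mk_surjective x
    exact congrArg (mk A) (star_star x)
  star_mul x y := by
    obtain ⟨x, rfl⟩ := mk_surjective x
    obtain ⟨y, rfl⟩ := mk_surjective y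
    exact (congrArg (mk A) (star_mul x y)).trans (map_mul (mk A) _ _)
  star_add x y := by
    obtain ⟨x, rfl⟩ := mk_surjective x
    obtain ⟨y, rfl⟩ := mk_surjective y
    exact (congrArg (mk A) (star_add x y)).trans (map_add (mk A) _ _)

@[simp]
theorem star_mk (x : 𝓜(ℂ, A)) : star (mk A x) = mk A (star x) := rfl

instance instStarModule : StarModule ℂ (Corona A) where
  star_smul c x := by
    obtain ⟨x, rfl⟩ := mk_surjective x
    rw [← map_smul, star_mk, star_mk, star_smul, map_smul]

noncomputable instance instNormedAddCommGroup : NormedAddCommGroup (Corona A) :=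
  inferInstanceAs (NormedAddCommGroup (𝓜(ℂ, A) ⧸ multiplierIdeal A))

instance instCompleteSpace : CompleteSpace (Corona A) :=
  inferInstanceAs (CompleteSpace (𝓜(ℂ, A) ⧸ multiplierIdeal A))

theorem norm_mk_le (x : 𝓜(ℂ, A)) : ‖mk A x‖ ≤ ‖x‖ :=
  Submodule.Quotient.norm_mk_le (multiplierIdeal A) x

theorem exists_norm_lt (x : Corona A) {ε : ℝ} (hε : 0 < ε) :
    ∃ m : 𝓜(ℂ, A), mk A m = x ∧ ‖m‖ < ‖x‖ + ε :=
  Submodule.Quotient.norm_mk_lt (S := multiplierIdeal A) x hε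

noncomputable instance instNormedRing : NormedRing (Corona A) where
  __ := instRing A
  __ := instNormedAddCommGroup
  norm_mul_le x y := by
    have h : ∀ ε > 0, ‖x * y‖ ≤ (‖x‖ + ε) * (‖y‖ + ε) := by
      intro ε hε
      obtain ⟨a, ha, ha'⟩ := exists_norm_lt x hε
      obtain ⟨b, hb, hb'⟩ := exists_norm_lt y hε
      calc ‖x * y‖ = ‖mk A (a * b)‖ := by rw [map_mul, ha, hb]
        _ ≤ ‖a * b‖ := norm_mk_le _
        _ ≤ ‖a‖ * ‖b‖ := norm_mul_le _ _
        _ ≤ (‖x‖ + ε) * (‖y‖ + ε) := by gcongr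
    have hlim : Tendsto (fun ε : ℝ => (‖x‖ + ε) * (‖y‖ + ε)) (𝓝[>] 0) (𝓝 (‖x‖ * ‖y‖)) := by
      have hc : Continuous fun ε : ℝ => (‖x‖ + ε) * (‖y‖ + ε) := by fun_prop
      simpa using (hc.tendsto 0).mono_left nhdsWithin_le_nhds
    exact ge_of_tendsto hlim (eventually_mem_nhdsWithin.mono fun ε hε => h ε hε)

noncomputable instance instNormedAlgebra : NormedAlgebra ℂ (Corona A) where
  __ := instAlgebra A
  norm_smul_le c x := norm_smul_le (β := 𝓜(ℂ, A) ⧸ multiplierIdeal A) c x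

/-- Elements of `A` which act almost as a right unit on a given element of `A`. -/
theorem exists_approx_unit (a : A) {ε : ℝ} (hε : 0 < ε) :
    ∃ e : A, star e = e ∧ ‖1 - (e : 𝓜(ℂ, A))‖ ≤ 1 ∧ ‖a - a * e‖ < ε := by
  let _ := CStarAlgebra.spectralOrder A
  have := CStarAlgebra.spectralOrderedRing A
  let _ := CStarAlgebra.spectralOrder 𝓜(ℂ, A)
  have := CStarAlgebra.spectralOrderedRing 𝓜(ℂ, A)
  have hu := CStarAlgebra.increasingApproximateUnit A
  have h1 := (hu.tendsto_mul_left a).eventually (Metric.ball_mem_nhds a hε)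
  obtain ⟨e, he, hpos, hnorm⟩ := (h1.and (hu.eventually_nonneg.and hu.eventually_norm)).exists
  refine ⟨e, (IsSelfAdjoint.of_nonneg hpos).star_eq, ?_, ?_⟩
  · have hpos' : (0 : 𝓜(ℂ, A)) ≤ (e : 𝓜(ℂ, A)) := by
      obtain ⟨b, rfl⟩ := CStarAlgebra.nonneg_iff_eq_star_mul_self.mp hpos
      have h : ((star b * b : A) : 𝓜(ℂ, A)) = star (b : 𝓜(ℂ, A)) * (b : 𝓜(ℂ, A)) := by
        change DoubleCentralizer.coeHom (𝕜 := ℂ) (star b * b) = _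
        rw [map_mul, map_star]
        rfl
      rw [h]
      exact star_mul_self_nonneg _
    have hle : (e : 𝓜(ℂ, A)) ≤ 1 := by
      rw [← CStarAlgebra.norm_le_one_iff_of_nonneg _ hpos', norm_coe_multiplier]
      exact hnorm
    rw [CStarAlgebra.norm_le_one_iff_of_nonneg _ (sub_nonneg.mpr hle)]
    exact sub_le_self _ hpos'
  · rw [← dist_eq_norm, dist_comm]
    exact he

instance instCStarRing : CStarRing (Corona A) where
  norm_mul_self_le x := by
    obtain ⟨m, rfl⟩ := mk_surjective x
    refine le_of_forall_pos_le_add fun ε hε => ?_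
    obtain ⟨z, hz, hz'⟩ := exists_norm_lt (star (mk A m) * mk A m) (half_pos hε)
    rw [star_mk, ← map_mul, mk_eq_mk_iff] at hz
    obtain ⟨a, ha⟩ := mem_multiplierIdeal.mp hz
    obtain ⟨e, he, he1, hea⟩ := exists_approx_unit a (half_pos hε)
    have hstar : star (1 - (e : 𝓜(ℂ, A))) = 1 - (e : 𝓜(ℂ, A)) := by
      rw [star_sub, star_one]
      congr 1
      exact (map_star (DoubleCentralizer.coeHom (𝕜 := ℂ) (A := A)) e).symm.trans
        (congrArg _ he)
    have hmk : mk A (m * (1 - (e : 𝓜(ℂ, A)))) = mk A m := by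
      rw [mk_eq_mk_iff, mul_sub, mul_one, sub_sub_cancel_left, neg_mem_iff]
      exact (multiplierIdeal A).mul_mem_left _ ⟨e, rfl⟩
    have hae : ‖(a : 𝓜(ℂ, A)) * (1 - (e : 𝓜(ℂ, A)))‖ ≤ ε / 2 := by
      have h : (a : 𝓜(ℂ, A)) * (1 - (e : 𝓜(ℂ, A))) = ((a - a * e : A) : 𝓜(ℂ, A)) := by
        change DoubleCentralizer.coeHom (𝕜 := ℂ) a * (1 - DoubleCentralizer.coeHom (𝕜 := ℂ) e) =
          DoubleCentralizer.coeHom (𝕜 := ℂ) (a - a * e)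
        rw [map_sub, map_mul, mul_sub, mul_one]
      rw [h, norm_coe_multiplier]
      exact hea.le
    have hm : star m * m = z - (a : 𝓜(ℂ, A)) := by rw [ha]; abel
    set f : 𝓜(ℂ, A) := 1 - (e : 𝓜(ℂ, A)) with hf
    calc ‖mk A m‖ * ‖mk A m‖ ≤ ‖m * f‖ * ‖m * f‖ := by
          rw [← hmk]
          gcongr <;> exact norm_mk_le _
      _ = ‖f * ((star m * m) * f)‖ := by
          rw [← CStarRing.norm_star_mul_self, star_mul, hstar]
          simp only [mul_assoc]
      _ ≤ ‖f‖ * ‖(star m * m) * f‖ := norm_mul_le _ _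
      _ ≤ 1 * ‖(star m * m) * f‖ := by gcongr
      _ = ‖z * f - (a : 𝓜(ℂ, A)) * f‖ := by rw [one_mul, hm, sub_mul]
      _ ≤ ‖z * f‖ + ‖(a : 𝓜(ℂ, A)) * f‖ := norm_sub_le _ _
      _ ≤ ‖z‖ * 1 + ε / 2 := by
          gcongr
          exact (norm_mul_le _ _).trans (by gcongr)
      _ ≤ ‖star (mk A m) * mk A m‖ + ε := by linarith

noncomputable instance instCStarAlgebra : CStarAlgebra (Corona A) where

end Corona

/-!
Write `Π : M(E) → M(B)` for the extension of `π` to multipliers. Since `E` is σ-unital, `Π` is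
surjective (`DoubleCentralizer.map_surjective`, the noncommutative Tietze theorem), and so is the
induced map of corona algebras. The lower bounds follow, because the real rank does not increase
under surjections (`realRank_le_of_surjective`).

For the upper bounds, let `J` be the kernel of `Π`, that is, the multipliers sending `E` into `A`.
Restriction to `A` embeds `J` as a hereditary subalgebra of `M(A)`
(`DoubleCentralizer.exists_restrict_eq_mul_mul`), and an element of `J` lies in `E` exactly when its
restriction lies in `A` (`DoubleCentralizer.exists_coe_eq_restrict_iff`). So the kernels of
`M(E) → M(B)` and of the map of coronas are the images of `J` modulo `0` and modulo `A`; in both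
cases this ideal is hereditary in an algebra `C`, namely `M(A)` or its corona, which has real rank
zero.

It remains to see that the real rank grows by at most one in an extension `D → Q` by such an ideal
(`HasDenseUnimodularTuples.succ_of_extension`). Let `(b, a)` be a self-adjoint tuple in `D` with `b`
a single element. Perturb `a` so that its image in `Q` is unimodular; then the left ideal generated
by `a` contains `1 - c` for some `c` in the ideal. As `C` has real rank zero, there is a projection
`p` in the ideal with `p * c` close to `c` (`exists_isStarProjection_norm_sub_le`), and the
compression of `b` to `p` can be made invertible in the corner at `p` by a small perturbation of
`b`, with a bound on the inverse `z` that does not depend on `p` (`exists_corner_perturbation`).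
With `w = z * b` one has `w * p = p`, and the left ideal generated by the perturbed tuple contains
`w + (1 - w) * (1 - c) = 1 - (1 - w) * (c - p * c)`, which is invertible.
-/

/-! ### Double centralizers and their functoriality -/

namespace DoubleCentralizer

section Construction

variable {A : Type*} [NonUnitalCStarAlgebra A]

/-- The left regular representation of a C⋆-algebra is faithful. -/
theorem eq_of_forall_mul_eq {a b : A} (h : ∀ z : A, z * a = z * b) : a = b := by
  have h' := h (star (a - b))
  rwa [← sub_eq_zero, ← mul_sub, CStarRing.star_mul_self_eq_zero_iff, sub_eq_zero] at h'

theorem eq_of_forall_eq_mul {a b : A} (h : ∀ z : A, a * z = b * z) : a = b := by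
  have h' := h (star (a - b))
  rwa [← sub_eq_zero, ← sub_mul, CStarRing.mul_star_self_eq_zero_iff, sub_eq_zero] at h'

/-- Linearity and boundedness of a double centralizer are automatic: any two maps `L`, `R` with
`R x * y = x * L y` form one. Boundedness comes from the closed graph theorem. -/
noncomputable def ofCentral (L R : A → A) (h : ∀ x y, R x * y = x * L y) : 𝓜(ℂ, A) where
  fst := ContinuousLinearMap.ofSeqClosedGraph
    (g := { toFun := L
            map_add' := fun x y => eq_of_forall_mul_eq fun z => by
              rw [mul_add, ← h, ← h, ← h, mul_add]
            map_smul' := fun c x => eq_of_forall_mul_eq fun z => by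
              rw [RingHom.id_apply, mul_smul_comm, ← h, ← h, mul_smul_comm] }) (by
      intro u x y hu hy
      refine eq_of_forall_mul_eq fun z => ?_
      refine tendsto_nhds_unique (hy.const_mul z) ?_
      change Tendsto (fun n => z * L (u n)) atTop (𝓝 (z * L x))
      simp only [← h]
      exact hu.const_mul (R z))
  snd := ContinuousLinearMap.ofSeqClosedGraph
    (g := { toFun := R
            map_add' := fun x y => eq_of_forall_eq_mul fun z => by
              rw [add_mul, h, h, h, add_mul]
            map_smul' := fun c x => eq_of_forall_eq_mul fun z => by
              rw [RingHom.id_apply, smul_mul_assoc, h, h, smul_mul_assoc] }) (by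
      intro u x y hu hy
      refine eq_of_forall_eq_mul fun z => ?_
      refine tendsto_nhds_unique (hy.mul_const z) ?_
      change Tendsto (fun n => R (u n) * z) atTop (𝓝 (R x * z))
      simp only [h]
      exact hu.mul_const (L z))
  central := h

@[simp]
theorem ofCentral_fst (L R : A → A) (h : ∀ x y, R x * y = x * L y) (x : A) :
    (ofCentral L R h).fst x = L x := rfl

theorem ext_of_fst {m n : 𝓜(ℂ, A)} (h : ∀ x, m.fst x = n.fst x) : m = n := by
  refine DoubleCentralizer.ext _ _ _ _ (Prod.ext (ContinuousLinearMap.ext h)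
    (ContinuousLinearMap.ext fun x => eq_of_forall_eq_mul fun z => ?_))
  rw [m.central, n.central, h]

theorem fst_mul (m : 𝓜(ℂ, A)) (x y : A) : m.fst (x * y) = m.fst x * y :=
  eq_of_forall_mul_eq fun z => by rw [← m.central, ← mul_assoc, ← mul_assoc, m.central]

theorem fst_apply_mul (m n : 𝓜(ℂ, A)) (x : A) : (m * n).fst x = m.fst (n.fst x) := rfl

theorem fst_apply_coe (a x : A) : (a : 𝓜(ℂ, A)).fst x = a * x := rfl

theorem norm_fst_apply_le (m : 𝓜(ℂ, A)) (x : A) : ‖m.fst x‖ ≤ ‖m‖ * ‖x‖ :=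
  (m.fst.le_opNorm x).trans_eq (by rw [norm_fst])

end Construction

section Map

variable {E B : Type*} [NonUnitalCStarAlgebra E] [NonUnitalCStarAlgebra B] (π : E →⋆ₙₐ[ℂ] B)

/-- Closed ideals of a C⋆-algebra are invariant under its multipliers: the square of the norm of
`π (m x)` is the norm of `π` of a left multiple of `x`. -/
theorem map_fst_eq_zero (m : 𝓜(ℂ, E)) {x : E} (hx : π x = 0) : π (m.fst x) = 0 := by
  rw [← CStarRing.star_mul_self_eq_zero_iff, ← map_star, ← map_mul, ← m.central, map_mul, hx,
    mul_zero]

theorem map_snd_eq_zero (m : 𝓜(ℂ, E)) {x : E} (hx : π x = 0) : π (m.snd x) = 0 := by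
  rw [← CStarRing.mul_star_self_eq_zero_iff, ← map_star, ← map_mul, m.central, map_mul, hx,
    zero_mul]

variable {π} (hπ : Function.Surjective π)

theorem map_fst_congr (m : 𝓜(ℂ, E)) {x y : E} (h : π x = π y) :
    π (m.fst x) = π (m.fst y) := by
  rw [← sub_eq_zero, ← map_sub, ← map_sub]
  exact map_fst_eq_zero π m (by rw [map_sub, h, sub_self])

theorem map_snd_congr (m : 𝓜(ℂ, E)) {x y : E} (h : π x = π y) :
    π (m.snd x) = π (m.snd y) := by
  rw [← sub_eq_zero, ← map_sub, ← map_sub]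
  exact map_snd_eq_zero π m (by rw [map_sub, h, sub_self])

/-- The multiplier of a quotient induced by a multiplier. -/
noncomputable def mapFun (m : 𝓜(ℂ, E)) : 𝓜(ℂ, B) :=
  ofCentral (fun b => π (m.fst (Function.surjInv hπ b)))
    (fun b => π (m.snd (Function.surjInv hπ b)))
    fun x y => by
      conv_lhs => rw [← Function.surjInv_eq hπ y, ← map_mul, m.central, map_mul]
      rw [Function.surjInv_eq hπ x]

theorem mapFun_fst (m : 𝓜(ℂ, E)) (e : E) : (mapFun hπ m).fst (π e) = π (m.fst e) :=
  map_fst_congr m (Function.surjInv_eq hπ (π e))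

theorem mapFun_snd (m : 𝓜(ℂ, E)) (e : E) : (mapFun hπ m).snd (π e) = π (m.snd e) :=
  map_snd_congr m (Function.surjInv_eq hπ (π e))

theorem ext_of_fst_map {m n : 𝓜(ℂ, B)} (hπ : Function.Surjective π)
    (h : ∀ e, m.fst (π e) = n.fst (π e)) : m = n :=
  ext_of_fst fun x => by obtain ⟨e, rfl⟩ := hπ x; exact h e

/-- The unital ⋆-homomorphism `M(E) → M(B)` extending a surjection `E → B`. -/
noncomputable def map : 𝓜(ℂ, E) →⋆ₐ[ℂ] 𝓜(ℂ, B) where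
  toFun := mapFun hπ
  map_one' := ext_of_fst_map hπ fun e => mapFun_fst hπ _ e
  map_mul' m n := ext_of_fst_map hπ fun e => by
    simp only [fst_apply_mul, mapFun_fst]
  map_zero' := ext_of_fst_map hπ fun e => (mapFun_fst hπ _ e).trans (map_zero π)
  map_add' m n := ext_of_fst_map hπ fun e => (mapFun_fst hπ _ e).trans <| by
    simp only [add_fst, _root_.add_apply, map_add, mapFun_fst]
  commutes' c := ext_of_fst_map hπ fun e => (mapFun_fst hπ _ e).trans <| by
    simp only [Algebra.algebraMap_eq_smul_one]
    exact map_smul π c e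
  map_star' m := ext_of_fst_map hπ fun e => (mapFun_fst hπ _ e).trans <| by
    rw [star_fst, star_fst, map_star π, ← map_star π e, mapFun_snd]

theorem map_fst (m : 𝓜(ℂ, E)) (e : E) : (map hπ m).fst (π e) = π (m.fst e) := mapFun_fst hπ m e

theorem map_snd (m : 𝓜(ℂ, E)) (e : E) : (map hπ m).snd (π e) = π (m.snd e) := mapFun_snd hπ m e

theorem map_coe (e : E) : map hπ (e : 𝓜(ℂ, E)) = (π e : 𝓜(ℂ, B)) :=
  ext_of_fst_map hπ fun x => by rw [map_fst, fst_apply_coe, fst_apply_coe, map_mul]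

theorem map_eq_zero_iff {m : 𝓜(ℂ, E)} : map hπ m = 0 ↔ ∀ e, π (m.fst e) = 0 := by
  refine ⟨fun h e => ?_, fun h => ext_of_fst_map hπ fun e => (map_fst hπ m e).trans (h e)⟩
  rw [← map_fst hπ, h]
  rfl

end Map

section Restrict

variable {A E B : Type*} [NonUnitalCStarAlgebra A] [NonUnitalCStarAlgebra E]
  [NonUnitalCStarAlgebra B] {ι : A →⋆ₙₐ[ℂ] E} {π : E →⋆ₙₐ[ℂ] B} (hext : IsCStarExtension ι π)
include hext

theorem exists_fst_eq (m : 𝓜(ℂ, E)) (a : A) : ∃ b, ι b = m.fst (ι a) :=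
  (hext.exact _).mp (map_fst_eq_zero π m ((hext.exact _).mpr ⟨a, rfl⟩))

theorem exists_snd_eq (m : 𝓜(ℂ, E)) (a : A) : ∃ b, ι b = m.snd (ι a) :=
  (hext.exact _).mp (map_snd_eq_zero π m ((hext.exact _).mpr ⟨a, rfl⟩))

/-- The restriction of a multiplier to an ideal. -/
noncomputable def restrictFun (m : 𝓜(ℂ, E)) : 𝓜(ℂ, A) :=
  ofCentral (fun a => (exists_fst_eq hext m a).choose) (fun a => (exists_snd_eq hext m a).choose)
    fun x y => hext.injective <| by
      rw [map_mul, map_mul, (exists_fst_eq hext m y).choose_spec,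
        (exists_snd_eq hext m x).choose_spec, m.central]

theorem restrictFun_fst (m : 𝓜(ℂ, E)) (a : A) :
    ι ((restrictFun hext m).fst a) = m.fst (ι a) :=
  (exists_fst_eq hext m a).choose_spec

theorem restrictFun_snd (m : 𝓜(ℂ, E)) (a : A) :
    ι ((restrictFun hext m).snd a) = m.snd (ι a) :=
  (exists_snd_eq hext m a).choose_spec

theorem ext_of_map_fst {m n : 𝓜(ℂ, A)} (h : ∀ a, ι (m.fst a) = ι (n.fst a)) : m = n :=
  ext_of_fst fun a => hext.injective (h a)

/-- The restriction homomorphism `M(E) → M(A)` for an ideal `A` of `E`. -/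
noncomputable def restrict : 𝓜(ℂ, E) →⋆ₙₐ[ℂ] 𝓜(ℂ, A) where
  toFun := restrictFun hext
  map_mul' m n := ext_of_map_fst hext fun a => by
    simp only [fst_apply_mul, restrictFun_fst]
  map_zero' := ext_of_map_fst hext fun a => (restrictFun_fst hext _ a).trans (map_zero ι).symm
  map_add' m n := ext_of_map_fst hext fun a => (restrictFun_fst hext _ a).trans <| by
    simp only [add_fst, _root_.add_apply, map_add, restrictFun_fst]
  map_smul' c m := ext_of_map_fst hext fun a => (restrictFun_fst hext _ a).trans <| by
    refine Eq.trans ?_ (map_smul ι c _).symm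
    exact congrArg (c • ·) (restrictFun_fst hext m a).symm
  map_star' m := ext_of_map_fst hext fun a => (restrictFun_fst hext _ a).trans <| by
    rw [star_fst, star_fst, map_star ι, restrictFun_snd, map_star ι]

theorem restrict_fst (m : 𝓜(ℂ, E)) (a : A) : ι ((restrict hext m).fst a) = m.fst (ι a) :=
  restrictFun_fst hext m a

theorem restrict_coe (a : A) : restrict hext (ι a : 𝓜(ℂ, E)) = (a : 𝓜(ℂ, A)) :=
  ext_of_map_fst hext fun x => by rw [restrict_fst, fst_apply_coe, fst_apply_coe, map_mul]

/-- The multipliers of `E` that vanish in `M(B)` are those that send `E` into `A`. -/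
theorem exists_fst_eq_of_map_eq_zero {m : 𝓜(ℂ, E)} (hm : map hext.surjective m = 0) (e : E) :
    ∃ a, ι a = m.fst e :=
  (hext.exact _).mp ((map_eq_zero_iff hext.surjective).mp hm e)

theorem exists_snd_eq_of_map_eq_zero {m : 𝓜(ℂ, E)} (hm : map hext.surjective m = 0) (e : E) :
    ∃ a, ι a = m.snd e :=
  (hext.exact _).mp (by rw [← map_snd hext.surjective, hm]; rfl)

/-- Restriction to `A` is injective on the kernel of `M(E) → M(B)`. -/
theorem eq_zero_of_restrict_eq_zero {m : 𝓜(ℂ, E)} (hm : map hext.surjective m = 0)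
    (h : restrict hext m = 0) : m = 0 := by
  have h1 : ∀ a, m.fst (ι a) = 0 := fun a => by
    rw [← restrict_fst hext, h]
    exact map_zero ι
  refine ext_of_fst fun e => ?_
  change m.fst e = 0
  -- `(m e)⋆ (m e) = (m⋆ (m e))⋆ e` where both `m e` and its image lie in `A`
  rw [← CStarRing.star_mul_self_eq_zero_iff, ← m.central]
  obtain ⟨a, ha⟩ := exists_fst_eq_of_map_eq_zero hext hm e
  have h2 : m.snd (star (m.fst e)) = 0 := by
    rw [← ha, ← map_star, ← CStarRing.mul_star_self_eq_zero_iff]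
    obtain ⟨c, hc⟩ := exists_snd_eq hext m (star a)
    rw [← hc, ← map_star, hc, m.central, h1, mul_zero]
  rw [h2, zero_mul]

/-- The kernel of `M(E) → M(B)` is hereditary in `M(A)`: for `j`, `k` in it and `x ∈ M(A)`, the
product `j x k` makes sense as a multiplier of `E`. -/
theorem exists_restrict_eq_mul_mul {j k : 𝓜(ℂ, E)} (hj : map hext.surjective j = 0)
    (hk : map hext.surjective k = 0) (x : 𝓜(ℂ, A)) :
    ∃ m : 𝓜(ℂ, E), map hext.surjective m = 0 ∧
      restrict hext m = restrict hext j * x * restrict hext k := by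
  choose f hf using exists_fst_eq_of_map_eq_zero hext hk
  choose g hg using exists_snd_eq_of_map_eq_zero hext hj
  refine ⟨ofCentral (fun e => j.fst (ι (x.fst (f e)))) (fun e => k.snd (ι (x.snd (g e))))
    fun s t => ?_, ?_, ?_⟩
  · rw [k.central, ← hf, ← map_mul, x.central, map_mul, hg, j.central]
  · rw [map_eq_zero_iff]
    exact fun e => map_fst_eq_zero π j ((hext.exact _).mpr ⟨_, rfl⟩)
  · refine ext_of_map_fst hext fun a => ?_
    rw [restrict_fst, ofCentral_fst, fst_apply_mul, fst_apply_mul, restrict_fst]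
    have : f (ι a) = (restrict hext k).fst a := hext.injective (by rw [hf, restrict_fst])
    rw [this]

end Restrict

end DoubleCentralizer

/-! ### Real rank zero -/

theorem hasDenseUnimodularTuples_zero_of_realRank_eq_zero {C : Type*} [CStarAlgebra C]
    (h : realRank C = 0) : HasDenseUnimodularTuples C 0 := by
  by_contra hC
  have : (1 : ℕ∞) ≤ realRank C := by
    refine le_iInf fun n => le_iInf fun hn => ?_
    rcases n with _ | n
    · exact absurd hn hC
    · exact_mod_cast Nat.succ_le_succ (Nat.zero_le n)
  rw [h] at this
  exact absurd this (by simp)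

theorem isUnit_of_isSelfAdjoint_of_mul_eq_one {C : Type*} [Ring C] [StarRing C] {x y : C}
    (hx : IsSelfAdjoint x) (h : y * x = 1) : IsUnit x := by
  have h' : x * star y = 1 := by rw [← hx.star_eq, ← star_mul, h, star_one]
  have : y = star y := left_inv_eq_right_inv h h'
  exact ⟨⟨x, y, by rw [this, h'], h⟩, rfl⟩

/-- In a unital C⋆-algebra of real rank zero the self-adjoint units are dense among the
self-adjoint elements. -/
theorem exists_isUnit_isSelfAdjoint_norm_sub_lt {C : Type*} [CStarAlgebra C]
    (hC : HasDenseUnimodularTuples C 0) {a : C} (ha : IsSelfAdjoint a) {ε : ℝ} (hε : 0 < ε) :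
    ∃ x : C, IsSelfAdjoint x ∧ IsUnit x ∧ ‖x - a‖ < ε := by
  obtain ⟨x, hx, hxU⟩ := Metric.dense_iff.mp hC (fun _ => ⟨a, ha⟩) ε hε
  refine ⟨x 0, (x 0).2, ?_, ?_⟩
  · have h1 : (1 : C) ∈ Ideal.span (Set.range fun i => (x i : C)) := by
      rw [hxU]; exact Submodule.mem_top
    rw [Ideal.mem_span_range_iff_exists_fun] at h1
    obtain ⟨c, hc⟩ := h1
    rw [Fin.sum_univ_succ, Fin.sum_univ_zero, add_zero] at hc
    exact isUnit_of_isSelfAdjoint_of_mul_eq_one (x 0).2 hc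
  · have := (dist_le_pi_dist x _ 0).trans_lt hx
    rwa [Subtype.dist_eq, dist_eq_norm] at this

/-- Opening a gap of size `θ` in the spectrum of a self-adjoint unit, by applying
`t ↦ t + θ sign t`. -/
theorem exists_gap_of_isUnit {C : Type*} [CStarAlgebra C] {x : C} (hx : IsSelfAdjoint x)
    (hu : IsUnit x) {θ : ℝ} (hθ : 0 < θ) :
    ∃ x' y : C, IsSelfAdjoint x' ∧ y * x' = 1 ∧ ‖y‖ ≤ θ⁻¹ ∧ ‖x' - x‖ ≤ θ := by
  have h0 : ∀ t ∈ spectrum ℝ x, t ≠ 0 := fun t ht h =>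
    spectrum.zero_notMem ℝ hu (h ▸ ht)
  have hs : ContinuousOn (fun t : ℝ => if 0 < t then (1 : ℝ) else -1) (spectrum ℝ x) := by
    intro t ht
    refine ContinuousAt.continuousWithinAt ?_
    rcases lt_or_gt_of_ne (h0 t ht) with h | h
    · refine (continuousAt_const (y := (-1 : ℝ))).congr ?_
      filter_upwards [gt_mem_nhds h] with s hs
      rw [if_neg (not_lt.mpr hs.le)]
    · refine (continuousAt_const (y := (1 : ℝ))).congr ?_
      filter_upwards [lt_mem_nhds h] with s hs
      rw [if_pos hs]
  set σ : ℝ → ℝ := fun t => if 0 < t then 1 else -1 with hσ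
  have habs : ∀ t ∈ spectrum ℝ x, θ ≤ |t + θ * σ t| := by
    intro t ht
    simp only [hσ]
    split_ifs with h
    · rw [abs_of_pos (by linarith)]; linarith
    · have := lt_of_le_of_ne (not_lt.mp h) (h0 t ht)
      rw [abs_of_neg (by linarith)]; linarith
  have hc : ContinuousOn (fun t => t + θ * σ t) (spectrum ℝ x) := by fun_prop
  have hne : ∀ t ∈ spectrum ℝ x, t + θ * σ t ≠ 0 := fun t ht h => by
    have := habs t ht
    rw [h, abs_zero] at this
    linarith
  refine ⟨cfc (fun t => t + θ * σ t) x, cfc (fun t => (t + θ * σ t)⁻¹) x, cfc_predicate _ _, ?_,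
    ?_, ?_⟩
  · rw [← cfc_mul (fun t => (t + θ * σ t)⁻¹) (fun t => t + θ * σ t) x (hc.inv₀ hne) hc,
      ← cfc_one ℝ x]
    exact cfc_congr fun t ht => inv_mul_cancel₀ (hne t ht)
  · refine norm_cfc_le (by positivity) fun t ht => ?_
    rw [norm_inv, Real.norm_eq_abs]
    exact inv_anti₀ hθ (habs t ht)
  · have h1 : cfc (fun t => t + θ * σ t) x - x = cfc (fun t => θ * σ t) x := by
      rw [cfc_add x (fun t => t) (fun t => θ * σ t) (by fun_prop) (by fun_prop), cfc_id' ℝ x,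
        add_sub_cancel_left]
    rw [h1]
    refine norm_cfc_le hθ.le fun t _ => ?_
    simp only [hσ]
    split_ifs <;> simp [abs_of_pos hθ]

/-- Schur complements: if `P` is a projection, `y * x = 1`, and `g` inverts the lower right corner
of `x` with respect to `P`, then `P * y * P` is a left inverse of the Schur complement of that
corner. -/
theorem schur_complement_left_inverse {C : Type*} [Ring C] {P x y g : C} (hP : P * P = P)
    (hyx : y * x = 1) (hg : (1 - P) * x * (1 - P) * g = 1 - P) :
    P * y * P * (P * x * P - P * x * (1 - P) * g * (1 - P) * x * P) = P := by
  have hQ : (1 - P) * (1 - P) = 1 - P := by noncomm_ring [hP]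
  have e1 : P * y * P * (P * x * P) = P - P * y * (1 - P) * x * P := by
    calc P * y * P * (P * x * P) = P * y * (P * P) * x * P := by noncomm_ring
      _ = P * (y * x) * P - P * y * (1 - P) * x * P := by rw [hP]; noncomm_ring
      _ = _ := by rw [hyx, mul_one, hP]
  have e2 : P * y * P * (P * x * (1 - P) * g * (1 - P) * x * P)
      = - (P * y * (1 - P) * x * P) := by
    calc P * y * P * (P * x * (1 - P) * g * (1 - P) * x * P)
        = P * y * (P * P) * x * (1 - P) * g * (1 - P) * x * P := by noncomm_ring
      _ = P * (y * x) * (1 - P) * g * (1 - P) * x * P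
          - P * y * (1 - P) * x * (1 - P) * g * (1 - P) * x * P := by rw [hP]; noncomm_ring
      _ = (P - P * P) * g * (1 - P) * x * P
          - P * y * ((1 - P) * x * (1 - P) * g) * (1 - P) * x * P := by
          rw [hyx]; noncomm_ring
      _ = - (P * y * ((1 - P) * (1 - P)) * x * P) := by rw [hg, hP]; noncomm_ring
      _ = _ := by rw [hQ]
  rw [mul_sub, e1, e2]; noncomm_ring


theorem CStarAlgebra.norm_one_le_one (C : Type*) [CStarAlgebra C] : ‖(1 : C)‖ ≤ 1 := by
  rcases subsingleton_or_nontrivial C with h | h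
  · rw [Subsingleton.elim (1 : C) 0, norm_zero]
    exact zero_le_one
  · rw [CStarRing.norm_one]

/-- A corner of an algebra of real rank zero has real rank zero, in a quantitative form: the
self-adjoint element `s` of the corner at `P` has a perturbation `s + k` of size `4θ` that is
invertible in the corner, with inverse `z` of norm at most `θ⁻¹`, whatever `s` and `P` are. -/
theorem exists_corner_perturbation {C : Type*} [CStarAlgebra C]
    (hC : HasDenseUnimodularTuples C 0) {P s : C} (hP : IsStarProjection P)
    (hs : IsSelfAdjoint s) (hPs : P * s * P = s) {θ : ℝ} (hθ : 0 < θ) (hθ' : θ ≤ 1 / 4) :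
    ∃ k z : C, IsSelfAdjoint k ∧ P * k * P = k ∧ P * z * P = z ∧ z * (s + k) = P ∧
      ‖z‖ ≤ θ⁻¹ ∧ ‖k‖ ≤ 4 * θ := by
  have hPP : P * P = P := hP.isIdempotentElem
  have hPsa : star P = P := hP.isSelfAdjoint
  have hPn : ‖P‖ ≤ 1 := hP.norm_le
  have hQn : ‖1 - P‖ ≤ 1 := hP.one_sub.norm_le
  have hs1 : P * s = s := by rw [← hPs, ← mul_assoc, ← mul_assoc, hPP]
  have hs2 : s * P = s := by rw [← hPs, mul_assoc, hPP]
  -- approximate `s` plus the complementary projection by an invertible element with a gap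
  obtain ⟨x₀, hx₀, hu₀, hd₀⟩ := exists_isUnit_isSelfAdjoint_norm_sub_lt hC
    (hs.add hP.one_sub.isSelfAdjoint) hθ
  obtain ⟨x, y, hx, hyx, hy, hd⟩ := exists_gap_of_isUnit hx₀ hu₀ hθ
  obtain ⟨u, hu⟩ : ∃ u, u = x - (s + (1 - P)) := ⟨_, rfl⟩
  have hun : ‖u‖ ≤ 2 * θ := by
    rw [hu, ← sub_add_sub_cancel x x₀]
    refine (norm_add_le _ _).trans ?_
    linarith
  have hxu : x = s + (1 - P) + u := by rw [hu]; abel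
  set v := (1 - P) * u * (1 - P) with hv
  have hvn : ‖v‖ ≤ 2 * θ := by
    calc ‖v‖ ≤ ‖1 - P‖ * ‖u‖ * ‖1 - P‖ := norm_mul₃_le
      _ ≤ 1 * (2 * θ) * 1 := by gcongr
      _ = _ := by ring
  have hvu : IsUnit (1 + v) := by
    have : IsUnit (1 - -v) := isUnit_one_sub_of_norm_lt_one (by rw [norm_neg]; linarith)
    rwa [sub_neg_eq_add] at this
  obtain ⟨g, hg⟩ := hvu.exists_right_inv
  have hgn : ‖g‖ ≤ 2 := by
    have h1 : g = 1 - v * g := by rw [← hg]; noncomm_ring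
    have h2 : ‖g‖ ≤ 1 + 2 * θ * ‖g‖ := by
      calc ‖g‖ = ‖1 - v * g‖ := by rw [← h1]
        _ ≤ ‖(1 : C)‖ + ‖v‖ * ‖g‖ := (norm_sub_le _ _).trans (by gcongr; exact norm_mul_le _ _)
        _ ≤ 1 + 2 * θ * ‖g‖ := by gcongr; exact CStarAlgebra.norm_one_le_one C
    nlinarith [norm_nonneg g]
  have hPQ : P * (1 - P) = 0 := by rw [mul_sub, mul_one, hPP, sub_self]
  have hQP : (1 - P) * P = 0 := by rw [sub_mul, one_mul, hPP, sub_self]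
  have hQQ : (1 - P) * (1 - P) = 1 - P := by rw [mul_sub, mul_one, hQP, sub_zero]
  have hQs : (1 - P) * s = 0 := by rw [sub_mul, one_mul, hs1, sub_self]
  have hsQ : s * (1 - P) = 0 := by rw [mul_sub, mul_one, hs2, sub_self]
  have hQxQ : (1 - P) * x * (1 - P) * g = 1 - P := by
    have : (1 - P) * x * (1 - P) = (1 - P) * (1 + v) := by
      rw [hxu, hv, mul_add, mul_add, add_mul, add_mul, hQs, hQQ, hQQ, mul_add, mul_one,
        ← mul_assoc, ← mul_assoc, hQQ, zero_mul, zero_add]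
    rw [this, mul_assoc, hg, mul_one]
  have hPxQ : P * x * (1 - P) = P * u * (1 - P) := by
    rw [hxu, mul_add, mul_add, add_mul, add_mul, hPQ, zero_mul, hs1, hsQ, zero_add, zero_add]
  have hQxP : (1 - P) * x * P = (1 - P) * u * P := by
    rw [hxu, mul_add, mul_add, add_mul, add_mul, hQs, hQQ, hQP, zero_mul, zero_add, zero_add]
  have hPxP : P * x * P = s + P * u * P := by
    rw [hxu, mul_add, mul_add, add_mul, add_mul, hPQ, zero_mul, hPs, add_zero]
  have husa : IsSelfAdjoint u := hu ▸ hx.sub (hs.add hP.one_sub.isSelfAdjoint)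
  have hQsa : star (1 - P) = 1 - P := hP.one_sub.isSelfAdjoint
  have hgsa : star g = g := by
    have hvsa : star v = v := by
      rw [hv, star_mul, star_mul, hQsa, husa.star_eq, mul_assoc]
    refine left_inv_eq_right_inv (a := 1 + v) ?_ hg
    have := congrArg star hg
    rwa [star_mul, star_add, star_one, hvsa] at this
  refine ⟨P * u * P - (P * u * (1 - P)) * g * ((1 - P) * u * P), P * y * P, ?_, ?_, ?_, ?_, ?_, ?_⟩
  · rw [IsSelfAdjoint, star_sub]
    simp only [star_mul, hPsa, hQsa, hgsa, husa.star_eq, mul_assoc]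
  · rw [mul_sub, sub_mul]
    simp only [mul_assoc, hPP]
    simp only [← mul_assoc, hPP]
  · simp only [mul_assoc, hPP]
    simp only [← mul_assoc, hPP]
  · have h := schur_complement_left_inverse hPP hyx hQxQ
    have h' : P * x * (1 - P) * g * (1 - P) * x * P
        = (P * u * (1 - P)) * g * ((1 - P) * u * P) := by
      rw [← hPxQ, ← hQxP]; simp only [mul_assoc]
    rw [h', hPxP] at h
    rw [← add_sub_assoc, h]
  · calc ‖P * y * P‖ ≤ ‖P‖ * ‖y‖ * ‖P‖ := norm_mul₃_le
      _ ≤ 1 * θ⁻¹ * 1 := by gcongr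
      _ = θ⁻¹ := by ring
  · have h1 : ‖P * u * P‖ ≤ 2 * θ := by
      calc ‖P * u * P‖ ≤ ‖P‖ * ‖u‖ * ‖P‖ := norm_mul₃_le
        _ ≤ 1 * (2 * θ) * 1 := by gcongr
        _ = _ := by ring
    have h2 : ‖P * u * (1 - P)‖ ≤ 2 * θ := by
      calc ‖P * u * (1 - P)‖ ≤ ‖P‖ * ‖u‖ * ‖1 - P‖ := norm_mul₃_le
        _ ≤ 1 * (2 * θ) * 1 := by gcongr
        _ = _ := by ring
    have h3 : ‖(1 - P) * u * P‖ ≤ 2 * θ := by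
      calc ‖(1 - P) * u * P‖ ≤ ‖1 - P‖ * ‖u‖ * ‖P‖ := norm_mul₃_le
        _ ≤ 1 * (2 * θ) * 1 := by gcongr
        _ = _ := by ring
    calc _ ≤ ‖P * u * P‖ + ‖P * u * (1 - P)‖ * ‖g‖ * ‖(1 - P) * u * P‖ :=
          (norm_sub_le _ _).trans (by gcongr; exact norm_mul₃_le)
      _ ≤ 2 * θ + 2 * θ * 2 * (2 * θ) := by gcongr
      _ ≤ 4 * θ := by nlinarith

/-- In an algebra of real rank zero, every `f` is almost absorbed on the left by a projection
`f w f⋆` of the hereditary subalgebra that it generates. -/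
theorem exists_isStarProjection_norm_sub_le {C : Type*} [CStarAlgebra C]
    (hC : HasDenseUnimodularTuples C 0) (f : C) {δ : ℝ} (hδ : 0 < δ) :
    ∃ w : C, IsStarProjection (f * w * star f) ∧ ‖f - f * w * star f * f‖ ≤ δ := by
  let _ := CStarAlgebra.spectralOrder C
  have := CStarAlgebra.spectralOrderedRing C
  set e := star f * f with he
  have hesa : IsSelfAdjoint e := .star_mul_self f
  obtain ⟨d, hd, hdδ⟩ : ∃ d : ℝ, 0 < d ∧ 3 / 2 * d ≤ δ ^ 2 :=
    ⟨δ ^ 2 / 2, by positivity, by nlinarith⟩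
  obtain ⟨x, hx, hxu, hxn⟩ := exists_isUnit_isSelfAdjoint_norm_sub_lt hC
    (hesa.sub (IsSelfAdjoint.algebraMap C (IsSelfAdjoint.all d))) (half_pos hd)
  set u := x - (e - algebraMap ℝ C d) with hu
  have husa : IsSelfAdjoint u :=
    hx.sub (hesa.sub (IsSelfAdjoint.algebraMap C (IsSelfAdjoint.all d)))
  have hu1 : u ≤ algebraMap ℝ C (d / 2) :=
    husa.le_algebraMap_norm_self.trans (algebraMap_mono C hxn.le)
  have hu2 : -u ≤ algebraMap ℝ C (d / 2) := by
    have := husa.neg.le_algebraMap_norm_self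
    rw [norm_neg] at this
    exact this.trans (algebraMap_mono C hxn.le)
  -- `q` is the spectral projection of `x` for the positive half-line
  have hq : ContinuousOn (fun t : ℝ => if 0 < t then (1 : ℝ) else 0) (spectrum ℝ x) := by
    intro t ht
    refine ContinuousAt.continuousWithinAt ?_
    rcases lt_or_gt_of_ne (fun h => spectrum.zero_notMem ℝ hxu (h ▸ ht) : t ≠ 0) with h | h
    · refine (continuousAt_const (y := (0 : ℝ))).congr ?_
      filter_upwards [gt_mem_nhds h] with s hs
      rw [if_neg (not_lt.mpr hs.le)]
    · refine (continuousAt_const (y := (1 : ℝ))).congr ?_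
      filter_upwards [lt_mem_nhds h] with s hs
      rw [if_pos hs]
  set χ : ℝ → ℝ := fun t => if 0 < t then 1 else 0 with hχ
  set q := cfc χ x with hqdef
  have hqsa : star q = q := (cfc_predicate χ x : IsSelfAdjoint q)
  have hqq : q * q = q := by
    rw [hqdef, ← cfc_mul χ χ x hq hq]
    refine cfc_congr fun t _ => ?_
    simp only [hχ]; split_ifs <;> simp
  have hqproj : IsStarProjection q := ⟨hqq, hqsa⟩
  have hpos : 0 ≤ q * x := by
    have : q * x = cfc (fun t => χ t * t) x := by
      rw [cfc_mul χ (fun t => t) x hq (by fun_prop), cfc_id' ℝ x]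
    rw [this]
    refine cfc_nonneg fun t _ => ?_
    simp only [hχ]; split_ifs with h
    · simpa using h.le
    · simp
  have hneg : (1 - q) * x ≤ 0 := by
    have : (1 - q) * x = cfc (fun t => (1 - χ t) * t) x := by
      rw [cfc_mul (fun t => 1 - χ t) (fun t => t) x (by fun_prop) (by fun_prop), cfc_id' ℝ x,
        cfc_sub (fun _ => 1) χ x (by fun_prop) hq, cfc_const_one ℝ x]
    rw [this]
    refine cfc_nonpos _ _ fun t _ => ?_
    simp only [hχ]; split_ifs with h
    · simp
    · simpa using h
  have hxq : x * q = q * x := by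
    have := (cfc_commute_cfc χ id x).eq
    rw [cfc_id ℝ x] at this
    exact this.symm
  have hqe : q * e * q - (d / 2) • q = q * x + q * (algebraMap ℝ C (d / 2) - u) * q := by
    have h1 : e = x + algebraMap ℝ C (d / 2) + (algebraMap ℝ C (d / 2) - u) := by
      rw [hu]
      have : algebraMap ℝ C d = algebraMap ℝ C (d / 2) + algebraMap ℝ C (d / 2) := by
        rw [← map_add, add_halves]
      rw [this]; abel
    rw [h1, mul_add, mul_add, add_mul, add_mul, mul_assoc q x, hxq, ← mul_assoc, hqq,
      Algebra.algebraMap_eq_smul_one, mul_smul_comm, mul_one, smul_mul_assoc, hqq]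
    abel
  have hqe' : (1 - q) * e * (1 - q)
      = (1 - q) * x + (1 - q) * (algebraMap ℝ C d - u) * (1 - q) := by
    have h1 : e = x + (algebraMap ℝ C d - u) := by rw [hu]; abel
    have h2 : x * (1 - q) = (1 - q) * x := by rw [mul_sub, sub_mul, hxq, mul_one, one_mul]
    rw [h1, mul_add, add_mul, mul_assoc _ x, h2, ← mul_assoc, hqproj.one_sub.isIdempotentElem.eq]
  have hlow : (d / 2) • q ≤ q * e * q := by
    rw [← sub_nonneg, hqe]
    refine add_nonneg hpos ?_
    have := star_left_conjugate_nonneg (sub_nonneg.mpr hu1) q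
    rwa [hqsa] at this
  have hup : (1 - q) * e * (1 - q) ≤ (3 / 2 * d) • (1 - q) := by
    have h1 : algebraMap ℝ C d - u ≤ algebraMap ℝ C (3 / 2 * d) := by
      have : algebraMap ℝ C (3 / 2 * d) = algebraMap ℝ C d + algebraMap ℝ C (d / 2) := by
        rw [← map_add]; congr 1; ring
      rw [this, sub_eq_add_neg]
      gcongr
    have h2 := star_left_conjugate_le_conjugate h1 (1 - q)
    rw [hqproj.one_sub.isSelfAdjoint.star_eq, Algebra.algebraMap_eq_smul_one (3 / 2 * d),
      mul_smul_comm, mul_one, smul_mul_assoc, hqproj.one_sub.isIdempotentElem.eq] at h2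
    rw [hqe']
    simpa using add_le_add hneg h2
  -- hence `e` is bounded below on the range of `q` and small on the range of `1 - q`
  have hfq : ‖f * (1 - q)‖ ≤ δ := by
    refine abs_le_of_sq_le_sq' ?_ hδ.le |>.2
    rw [sq, ← CStarRing.norm_star_mul_self, star_mul, hqproj.one_sub.isSelfAdjoint.star_eq,
      mul_assoc, ← mul_assoc (star f), ← he, ← mul_assoc]
    have h0 : 0 ≤ (1 - q) * e * (1 - q) := by
      have := star_left_conjugate_nonneg (star_mul_self_nonneg f) (1 - q)
      rwa [hqproj.one_sub.isSelfAdjoint.star_eq] at this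
    calc _ ≤ ‖(3 / 2 * d) • (1 - q)‖ := CStarAlgebra.norm_le_norm_of_nonneg_of_le h0 hup
      _ = 3 / 2 * d * ‖1 - q‖ := by rw [norm_smul, Real.norm_of_nonneg (by positivity)]
      _ ≤ 3 / 2 * d * 1 := by gcongr; exact hqproj.one_sub.norm_le
      _ ≤ δ ^ 2 := by linarith
  -- `S` is invertible, and its inverse inverts `q * e * q` in the corner at `q`
  set S := q * e * q + (1 - q) with hS
  have hSu : IsUnit S := by
    set c : ℝ := min (d / 2) 1 with hc
    have hc0 : 0 < c := lt_min (by positivity) one_pos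
    have hle : algebraMap ℝ C c ≤ S := by
      have : S - algebraMap ℝ C c
          = (q * e * q - (d / 2) • q) + (d / 2 - c) • q + (1 - c) • (1 - q) := by
        rw [hS, Algebra.algebraMap_eq_smul_one, sub_smul, sub_smul, smul_sub, smul_sub, one_smul,
          one_smul]
        abel
      rw [← sub_nonneg, this]
      exact add_nonneg (add_nonneg (sub_nonneg.mpr hlow)
        (smul_nonneg (sub_nonneg.mpr (min_le_left _ _)) hqproj.nonneg))
        (smul_nonneg (sub_nonneg.mpr (min_le_right _ _)) hqproj.one_sub.nonneg)
    refine CStarAlgebra.isUnit_of_le _ hle ⟨?_, ?_⟩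
    · exact algebraMap_nonneg C hc0.le
    · exact (IsUnit.mk0 c hc0.ne').map (algebraMap ℝ C)
  obtain ⟨r, hSr, hrS⟩ : ∃ r, S * r = 1 ∧ r * S = 1 := by
    obtain ⟨w, hw⟩ := hSu
    exact ⟨↑w⁻¹, by rw [← hw]; simp, by rw [← hw]; simp⟩
  have hSsa : star S = S := by
    rw [hS, star_add, star_sub, star_one, star_mul, star_mul, hqsa, hesa.star_eq,
      ← mul_assoc]
  have hrsa : star r = r := by
    refine left_inv_eq_right_inv (a := S) ?_ hSr
    have := congrArg star hSr
    rwa [star_mul, star_one, hSsa] at this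
  have hSq : S * q = q * e * q := by
    rw [hS, add_mul, mul_assoc _ q q, hqq, sub_mul, one_mul, hqq, sub_self, add_zero]
  have hr : r * (q * e * q) = q := by rw [← hSq, ← mul_assoc, hrS, one_mul]
  have hpf : f * (q * r * q) * star f * (f * q) = f * q := by
    calc _ = f * q * (r * (q * e * q)) := by rw [he]; simp only [mul_assoc]
      _ = f * q := by rw [hr, mul_assoc, hqq]
  have hpproj : IsStarProjection (f * (q * r * q) * star f) := by
    constructor
    · calc _ = f * (q * r * q) * star f * (f * q) * (r * q * star f) := by simp only [mul_assoc]
        _ = _ := by rw [hpf]; simp only [mul_assoc]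
    · simp only [IsSelfAdjoint, star_mul, star_star, hqsa, hrsa, mul_assoc]
  refine ⟨q * r * q, hpproj, ?_⟩
  set p := f * (q * r * q) * star f with hp
  have h1 : f - p * f = (1 - p) * (f * (1 - q)) := by
    have : (1 - p) * (f * q) = 0 := by rw [sub_mul, one_mul, hpf, sub_self]
    rw [mul_sub, mul_one, mul_sub, this, sub_zero, sub_mul, one_mul]
  rw [h1]
  calc _ ≤ ‖1 - p‖ * ‖f * (1 - q)‖ := norm_mul_le _ _
    _ ≤ 1 * δ := by gcongr; exact hpproj.one_sub.norm_le
    _ = δ := one_mul δ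

/-! ### Homomorphisms with the same kernel -/

section SameKernel

variable {J C D : Type*} [NonUnitalCStarAlgebra J] [NonUnitalCStarAlgebra C]
  [NonUnitalCStarAlgebra D]

open CStarAlgebra NonUnitalIsometricContinuousFunctionalCalculus in
/-- A homomorphism that factors algebraically through another one is dominated by it in norm: test
both on `f(s)` for `s` self-adjoint, where `f` vanishes exactly on `[-‖φ s‖, ‖φ s‖]`. -/
theorem norm_apply_le_of_ker_le (φ : J →⋆ₙₐ[ℂ] C) (i : J →⋆ₙₐ[ℂ] D)
    (h : ∀ x, φ x = 0 → i x = 0) (x : J) : ‖i x‖ ≤ ‖φ x‖ := by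
  have key : ∀ s : J, IsSelfAdjoint s → ‖i s‖ ≤ ‖φ s‖ := by
    intro s hs
    set f : ℝ → ℝ := fun t => max (|t| - ‖φ s‖) 0 with hf
    have hf0 : f 0 = 0 := by simp [hf]
    have hfc : Continuous f := by fun_prop
    have h1 : φ (cfcₙ f s) = 0 := by
      rw [NonUnitalStarAlgHomClass.map_cfcₙ φ f s hfc.continuousOn hf0 (map_continuous φ) hs
        (hs.map φ)]
      rw [cfcₙ_congr (g := fun _ => 0), cfcₙ_const_zero]
      intro t ht
      exact max_eq_right (sub_nonpos.mpr (norm_quasispectrum_le (φ s) ht (hs.map φ)))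
    have h2 := h _ h1
    rw [NonUnitalStarAlgHomClass.map_cfcₙ i f s hfc.continuousOn hf0 (map_continuous i) hs
      (hs.map i)] at h2
    obtain ⟨t, ht, hti⟩ := (isGreatest_norm_quasispectrum (𝕜 := ℝ) (i s) (hs.map i)).1
    have h3 := norm_apply_le_norm_cfcₙ f (i s) ht hfc.continuousOn hf0 (hs.map i)
    rw [h2, norm_zero] at h3
    have h4 : |t| - ‖φ s‖ ≤ f t := le_max_left _ _
    have h5 : f t ≤ ‖f t‖ := Real.le_norm_self _
    have h6 : |t| = ‖i s‖ := hti
    linarith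
  refine abs_le_of_sq_le_sq' ?_ (norm_nonneg _) |>.2
  have := key _ (IsSelfAdjoint.star_mul_self x)
  rwa [map_mul, map_mul, map_star, map_star, CStarRing.norm_star_mul_self,
    CStarRing.norm_star_mul_self, ← sq, ← sq] at this

theorem norm_apply_eq_of_ker_eq (φ : J →⋆ₙₐ[ℂ] C) (i : J →⋆ₙₐ[ℂ] D)
    (h : ∀ x, φ x = 0 ↔ i x = 0) (x : J) : ‖i x‖ = ‖φ x‖ :=
  le_antisymm (norm_apply_le_of_ker_le φ i (fun x => (h x).mp) x)
    (norm_apply_le_of_ker_le i φ (fun x => (h x).mpr) x)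

end SameKernel

/-! ### Real rank of quotients and of extensions by ideals of real rank zero -/

section Lifts

variable {D Q F : Type*} [NonUnitalCStarAlgebra D] [NonUnitalCStarAlgebra Q] [FunLike F D Q]
  [NonUnitalAlgHomClass F ℂ D Q] [StarHomClass F D Q]

open CStarAlgebra in
theorem exists_lift_norm_le (τ : F) (hτ : Function.Surjective τ) :
    ∃ K > 0, ∀ q : Q, ∃ d : D, τ d = q ∧ ‖d‖ ≤ K * ‖q‖ :=
  ContinuousLinearMap.exists_preimage_norm_le
    (⟨⟨⟨τ, map_add τ⟩, fun c x => map_smul τ c x⟩, map_continuous τ⟩ : D →L[ℂ] Q) hτ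

theorem exists_isSelfAdjoint_lift_norm_le (τ : F) (hτ : Function.Surjective τ) :
    ∃ K > 0, ∀ q : Q, IsSelfAdjoint q → ∃ d : D, IsSelfAdjoint d ∧ τ d = q ∧ ‖d‖ ≤ K * ‖q‖ := by
  obtain ⟨K, hK, h⟩ := exists_lift_norm_le τ hτ
  refine ⟨K, hK, fun q hq => ?_⟩
  obtain ⟨d, rfl, hd⟩ := h q
  refine ⟨(2⁻¹ : ℂ) • (d + star d), ?_, ?_, ?_⟩
  · rw [IsSelfAdjoint, star_smul, star_add, star_star, add_comm]
    simp
  · rw [map_smul, map_add, map_star, hq.star_eq, ← two_smul ℂ, smul_smul]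
    norm_num
  · calc _ ≤ ‖(2⁻¹ : ℂ)‖ * (‖d‖ + ‖star d‖) := by
          rw [norm_smul]; gcongr; exact norm_add_le _ _
      _ = ‖d‖ := by rw [norm_star]; norm_num; ring
      _ ≤ _ := hd

end Lifts

theorem IsUnimodularTuple.map {R S : Type*} [Ring R] [Ring S] (f : R →+* S) {n : ℕ}
    {a : Fin n → R} (ha : IsUnimodularTuple a) : IsUnimodularTuple fun k => f (a k) := by
  rw [IsUnimodularTuple, Ideal.eq_top_iff_one, Ideal.mem_span_range_iff_exists_fun] at ha ⊢
  obtain ⟨c, hc⟩ := ha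
  refine ⟨fun k => f (c k), ?_⟩
  simp only [← map_mul, ← map_sum, hc, map_one]

section Unital

variable {D Q : Type*} [CStarAlgebra D] [CStarAlgebra Q]

theorem HasDenseUnimodularTuples.of_surjective (τ : D →⋆ₐ[ℂ] Q) (hτ : Function.Surjective τ)
    {n : ℕ} (hD : HasDenseUnimodularTuples D n) : HasDenseUnimodularTuples Q n := by
  obtain ⟨K, -, hK⟩ := exists_isSelfAdjoint_lift_norm_le τ hτ
  refine Metric.dense_iff.mpr fun a ε hε => ?_
  choose d hd hda _ using fun k => hK (a k) (a k).2
  obtain ⟨x, hx, hxU⟩ := Metric.dense_iff.mp hD (fun k => ⟨d k, hd k⟩) ε hε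
  refine ⟨fun k => ⟨τ (x k), (x k).2.map τ⟩, ?_, hxU.map (τ : D →+* Q)⟩
  rw [Metric.mem_ball, dist_pi_lt_iff hε] at hx ⊢
  intro k
  refine lt_of_le_of_lt ?_ (hx k)
  rw [Subtype.dist_eq, Subtype.dist_eq, dist_eq_norm, dist_eq_norm]
  change ‖τ (x k) - a k‖ ≤ ‖x k - d k‖
  rw [← hda, ← map_sub]
  exact NonUnitalStarAlgHom.norm_apply_le τ _

theorem realRank_le_of_surjective (τ : D →⋆ₐ[ℂ] Q) (hτ : Function.Surjective τ) :
    realRank Q ≤ realRank D :=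
  le_iInf₂ fun n hn => iInf₂_le n (hn.of_surjective τ hτ)

/-- Unimodular perturbations in a quotient lift: the resulting tuple is unimodular modulo the
kernel. -/
theorem exists_perturbation_unimodular_mod (τ : D →⋆ₐ[ℂ] Q) (hτ : Function.Surjective τ) {n : ℕ}
    (hQ : HasDenseUnimodularTuples Q n) (a : Fin (n + 1) → selfAdjoint D) {ε : ℝ} (hε : 0 < ε) :
    ∃ a' : Fin (n + 1) → selfAdjoint D, (∀ k, dist (a' k) (a k) < ε) ∧
      ∃ c : Fin (n + 1) → D, τ (∑ k, c k * a' k) = 1 := by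
  obtain ⟨K, hK0, hK⟩ := exists_isSelfAdjoint_lift_norm_le τ hτ
  obtain ⟨x, hx, hxU⟩ := Metric.dense_iff.mp hQ (fun k => ⟨τ (a k), (a k).2.map τ⟩) (ε / K)
    (by positivity)
  rw [Metric.mem_ball, dist_pi_lt_iff (by positivity)] at hx
  choose d hd hdx hdn using fun k => hK (x k - τ (a k)) ((x k).2.sub ((a k).2.map τ))
  refine ⟨fun k => a k + ⟨d k, hd k⟩, fun k => ?_, ?_⟩
  · rw [dist_eq_norm, add_sub_cancel_left]
    have h1 := hx k
    rw [Subtype.dist_eq, dist_eq_norm] at h1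
    calc ‖d k‖ ≤ K * ‖(x k : Q) - τ (a k)‖ := hdn k
      _ < K * (ε / K) := by gcongr
      _ = ε := by field_simp
  · have h1 : (1 : Q) ∈ Ideal.span (Set.range fun k => (x k : Q)) := by
      rw [hxU]; exact Submodule.mem_top
    rw [Ideal.mem_span_range_iff_exists_fun] at h1
    obtain ⟨c, hc⟩ := h1
    choose c' hc' using fun k => hτ (c k)
    refine ⟨c', ?_⟩
    rw [← hc, map_sum]
    refine Finset.sum_congr rfl fun k _ => ?_
    rw [map_mul, hc']
    congr 1
    change τ (a k + d k) = x k
    rw [map_add, hdx, add_sub_cancel]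

/-- A left ideal containing `w` and `1 - c` contains `w + (1 - w) * (1 - c) = 1 - (1 - w) * c`. If
`w * p = p`, only the part `c - p * c` of `c` that is not absorbed by `p` matters here. -/
theorem left_ideal_eq_top_of_norm_lt {L : Ideal D} {p w c : D} (hw : w ∈ L) (hc : 1 - c ∈ L)
    (hwp : w * p = p) (hn : ‖(1 - w) * (c - p * c)‖ < 1) : L = ⊤ := by
  have h1 : w + (1 - w) * (1 - c) = 1 - (1 - w) * (c - p * c) := by
    have : (1 - w) * (p * c) = 0 := by rw [← mul_assoc, sub_mul, one_mul, hwp, sub_self, zero_mul]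
    rw [mul_sub _ c, this, mul_sub, mul_one]
    abel
  refine Ideal.eq_top_of_isUnit_mem L ?_ (isUnit_one_sub_of_norm_lt_one hn)
  rw [← h1]
  exact L.add_mem hw (L.mul_mem_left _ hc)

/-- The real rank grows by at most one in an extension by an ideal `i(J)` of real rank zero. That
the ideal has real rank zero is expressed by a second homomorphism `φ` on `J` with the same kernel
and with hereditary image in a unital algebra `C` of real rank zero. -/
theorem HasDenseUnimodularTuples.succ_of_extension {J C : Type*} [NonUnitalCStarAlgebra J]
    [CStarAlgebra C] (τ : D →⋆ₐ[ℂ] Q) (hτ : Function.Surjective τ) (i : J →⋆ₙₐ[ℂ] D)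
    (φ : J →⋆ₙₐ[ℂ] C) (hker : ∀ x, φ x = 0 ↔ i x = 0) (hτi : ∀ d, τ d = 0 ↔ ∃ x, i x = d)
    (hher : ∀ x y c, ∃ z, φ z = φ x * c * φ y) (hC : HasDenseUnimodularTuples C 0) {n : ℕ}
    (hQ : HasDenseUnimodularTuples Q n) : HasDenseUnimodularTuples D (n + 1) := by
  have hiso : ∀ x, ‖i x‖ = ‖φ x‖ := norm_apply_eq_of_ker_eq φ i hker
  have hcongr : ∀ {x y}, φ x = φ y ↔ i x = i y := fun {x y} => by
    rw [← sub_eq_zero, ← map_sub, hker, map_sub, sub_eq_zero]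
  refine Metric.dense_iff.mpr fun a ε hε => ?_
  obtain ⟨b, a, rfl⟩ : ∃ b a', a = Fin.cons b a' := ⟨a 0, Fin.tail a, (Fin.cons_self_tail a).symm⟩
  obtain ⟨a', ha', x, hx⟩ := exists_perturbation_unimodular_mod τ hτ hQ a hε
  obtain ⟨c, hc⟩ := (hτi (1 - ∑ k, x k * a' k)).mp (by rw [map_sub, hx, map_one, sub_self])
  -- the gap `θ` is fixed before the projection, whose accuracy `δ` has to depend on it
  obtain ⟨θ, hθ, hθ4, hθε⟩ : ∃ θ : ℝ, 0 < θ ∧ θ ≤ 1 / 4 ∧ 4 * θ < ε :=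
    ⟨min (1 / 4) (ε / 8), lt_min (by norm_num) (by positivity), min_le_left _ _, by
      have := min_le_right (1 / 4) (ε / 8)
      linarith⟩
  set M : ℝ := 1 + θ⁻¹ * (‖(b : D)‖ + ε) with hM
  have hM0 : 0 < M := by positivity
  obtain ⟨w, hproj, hsmall⟩ := exists_isStarProjection_norm_sub_le hC (φ c)
    (δ := (2 * M)⁻¹) (by positivity)
  obtain ⟨p, hp⟩ := hher c (star c) w
  rw [map_star] at hp
  rw [← hp] at hproj hsmall
  have hpp : i p * i p = i p := by
    rw [← map_mul, ← hcongr, map_mul]; exact hproj.isIdempotentElem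
  have hpsa : star (i p) = i p := by
    rw [← map_star, ← hcongr, map_star]; exact hproj.isSelfAdjoint
  have hpc : ‖i c - i p * i c‖ ≤ (2 * M)⁻¹ := by
    rwa [← map_mul, ← map_sub, hiso, map_sub, map_mul]
  -- perturb the compression `s` of `b` to the corner at `p`
  obtain ⟨s, hs⟩ := (hτi (i p * b * i p)).mp (by
    rw [map_mul, (hτi (i p)).mpr ⟨p, rfl⟩, mul_zero])
  have hssa : IsSelfAdjoint (φ s) := by
    rw [IsSelfAdjoint, ← map_star, hcongr, map_star, hs, star_mul, star_mul, hpsa,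
      (show star (b : D) = b from b.2), mul_assoc]
  have hps : φ p * φ s * φ p = φ s := by
    rw [← map_mul, ← map_mul, hcongr, map_mul, map_mul, hs]
    simp only [mul_assoc, hpp]
    simp only [← mul_assoc, hpp]
  obtain ⟨k₀, z₀, hk₀, hPk, hPz, hzk, hz₀, hk₀n⟩ :=
    exists_corner_perturbation hC hproj hssa hps hθ hθ4
  obtain ⟨k, hk⟩ := hher p p k₀
  obtain ⟨z, hz⟩ := hher p p z₀
  rw [hPk] at hk
  rw [hPz] at hz
  subst hk hz
  have hksa : IsSelfAdjoint (i k) := by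
    rw [IsSelfAdjoint, ← map_star, ← hcongr, map_star]; exact hk₀
  have hkn : ‖i k‖ ≤ 4 * θ := by rwa [hiso]
  have hzn : ‖i z‖ ≤ θ⁻¹ := by rwa [hiso]
  have hpk : i p * i k * i p = i k := by
    rw [← map_mul, ← map_mul, ← hcongr, map_mul, map_mul, hPk]
  have hzp : i z * i p = i z := by
    rw [← map_mul, ← hcongr, map_mul, ← hPz, mul_assoc, hproj.isIdempotentElem.eq]
  have hzsk : i z * (i s + i k) = i p := by
    rw [← map_add, ← map_mul, ← hcongr, map_mul, map_add, hzk]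
  refine ⟨Fin.cons (b + ⟨i k, hksa⟩) a', ?_, ?_⟩
  · rw [Metric.mem_ball, dist_pi_lt_iff hε]
    refine Fin.cases ?_ fun j => ?_
    · rw [Fin.cons_zero, Fin.cons_zero, dist_eq_norm, add_sub_cancel_left]
      exact hkn.trans_lt hθε
    · rw [Fin.cons_succ, Fin.cons_succ]
      exact ha' j
  · set L : Ideal D := Ideal.span (Set.range fun j =>
      ((Fin.cons (b + ⟨i k, hksa⟩) a' : Fin (n + 1 + 1) → selfAdjoint D) j : D)) with hL
    have hbL : (b : D) + i k ∈ L := Ideal.subset_span ⟨0, rfl⟩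
    have haL : ∀ j, (a' j : D) ∈ L := fun j => Ideal.subset_span ⟨j.succ, rfl⟩
    refine left_ideal_eq_top_of_norm_lt (p := i p) (w := i z * (b + i k)) (c := i c)
      (L.mul_mem_left _ hbL) ?_ ?_ ?_
    · rw [hc, sub_sub_cancel]
      exact L.sum_mem fun j _ => L.mul_mem_left _ (haL j)
    · calc i z * (b + i k) * i p = i z * (i p * (b + i k) * i p) := by
            conv_lhs => rw [← hzp]
            simp only [mul_assoc]
        _ = i z * (i s + i k) := by rw [mul_add, add_mul, hpk, hs]
        _ = i p := hzsk
    · calc _ ≤ ‖1 - i z * ((b : D) + i k)‖ * ‖i c - i p * i c‖ := norm_mul_le _ _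
        _ ≤ M * (2 * M)⁻¹ := by
          gcongr
          calc _ ≤ ‖(1 : D)‖ + ‖i z‖ * (‖(b : D)‖ + ‖i k‖) := by
                refine (norm_sub_le _ _).trans ?_
                gcongr
                refine (norm_mul_le _ _).trans ?_
                gcongr
                exact norm_add_le _ _
            _ ≤ 1 + θ⁻¹ * (‖(b : D)‖ + ε) := by
                gcongr
                · exact CStarAlgebra.norm_one_le_one D
                · exact hkn.trans hθε.le
        _ < 1 := by
          rw [mul_inv, mul_left_comm, mul_inv_cancel₀ hM0.ne']
          norm_num

theorem realRank_le_add_one_of_extension {J C : Type*} [NonUnitalCStarAlgebra J]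
    [CStarAlgebra C] (τ : D →⋆ₐ[ℂ] Q) (hτ : Function.Surjective τ) (i : J →⋆ₙₐ[ℂ] D)
    (φ : J →⋆ₙₐ[ℂ] C) (hker : ∀ x, φ x = 0 ↔ i x = 0) (hτi : ∀ d, τ d = 0 ↔ ∃ x, i x = d)
    (hher : ∀ x y c, ∃ z, φ z = φ x * c * φ y) (hC : realRank C = 0) :
    realRank D ≤ realRank Q + 1 := by
  rw [realRank, realRank, ENat.iInf_add]
  refine le_iInf fun n => ?_
  by_cases hn : HasDenseUnimodularTuples Q n
  · have := HasDenseUnimodularTuples.succ_of_extension τ hτ i φ hker hτi hher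
      (hasDenseUnimodularTuples_zero_of_realRank_eq_zero hC) hn
    rw [iInf_pos hn]
    exact (iInf₂_le (n + 1) this).trans_eq (by push_cast; rfl)
  · rw [iInf_neg hn]
    simp

end Unital

/-! ### Lifting multipliers along quotients of σ-unital C⋆-algebras -/

section Sums

variable {A : Type*} [NonUnitalCStarAlgebra A] [PartialOrder A] [StarOrderedRing A]

open scoped InnerProductSpace in
/-- The Cauchy–Schwarz inequality for a product of a row and a column over a C⋆-algebra. -/
theorem norm_sum_mul_le {κ : Type*} (s : Finset κ) (x y : κ → A) :
    ‖∑ j ∈ s, x j * y j‖ ≤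
      √‖∑ j ∈ s, x j * star (x j)‖ * √‖∑ j ∈ s, star (y j) * y j‖ := by
  let v : (WithCStarModule A (s → A)) :=
    (WithCStarModule.equiv A (s → A)).symm (fun j : s => star (y j))
  let w : (WithCStarModule A (s → A)) :=
    (WithCStarModule.equiv A (s → A)).symm (fun j : s => x j)
  have h := CStarModule.norm_inner_le (A := A) (WithCStarModule A (s → A)) (x := v) (y := w)
  rw [mul_comm, WithCStarModule.pi_norm, WithCStarModule.pi_norm, WithCStarModule.pi_inner] at h
  change ‖∑ j : s, x j * star (star (y j))‖ ≤ √‖∑ j : s, x j * star (x j)‖ *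
    √‖∑ j : s, star (y j) * star (star (y j))‖ at h
  simp only [star_star] at h
  rwa [Finset.sum_coe_sort s fun j => x j * y j, Finset.sum_coe_sort s fun j => x j * star (x j),
    Finset.sum_coe_sort s fun j => star (y j) * y j] at h

theorem mul_self_le_self {c : A} (hc : 0 ≤ c) (hc1 : ‖c‖ ≤ 1) : c * c ≤ c := by
  have h1 : c * c ≤ ‖c‖ • c := by
    have := CStarAlgebra.star_left_conjugate_le_norm_smul (a := CFC.sqrt c) (b := c)
    rwa [(CFC.sqrt_nonneg c).isSelfAdjoint.star_eq, CFC.sqrt_mul_sqrt_self c,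
      (show CFC.sqrt c * c * CFC.sqrt c = c * c by
        nth_rw 2 [← CFC.sqrt_mul_sqrt_self c]
        rw [← mul_assoc, CFC.sqrt_mul_sqrt_self c, mul_assoc, CFC.sqrt_mul_sqrt_self c])] at this
  refine h1.trans ?_
  calc ‖c‖ • c ≤ (1 : ℝ) • c := smul_le_smul_of_nonneg_right hc1 hc
    _ = c := one_smul ℝ c

/-- Block sums `∑ c_j y_j d_j` are bounded uniformly in their length when `c_j` and `d_j` are
positive contractions with bounded sums. -/
theorem norm_sum_mul_mul_le {κ : Type*} (s : Finset κ) {c y d : κ → A} {K : ℝ} (hK : 0 ≤ K)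
    (hc : ∀ j, 0 ≤ c j) (hc1 : ∀ j, ‖c j‖ ≤ 1) (hd : ∀ j, 0 ≤ d j) (hd1 : ∀ j, ‖d j‖ ≤ 1)
    (hy : ∀ j, ‖y j‖ ≤ K) :
    ‖∑ j ∈ s, c j * y j * d j‖ ≤ K * (√‖∑ j ∈ s, c j‖ * √‖∑ j ∈ s, d j‖) := by
  have h1 : ‖∑ j ∈ s, c j * star (c j)‖ ≤ ‖∑ j ∈ s, c j‖ := by
    refine CStarAlgebra.norm_le_norm_of_nonneg_of_le
      (Finset.sum_nonneg fun j _ => mul_star_self_nonneg _) (Finset.sum_le_sum fun j _ => ?_)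
    rw [(hc j).isSelfAdjoint.star_eq]
    exact mul_self_le_self (hc j) (hc1 j)
  have h2 : ‖∑ j ∈ s, star (y j * d j) * (y j * d j)‖ ≤ K ^ 2 * ‖∑ j ∈ s, d j‖ := by
    calc _ ≤ ‖(K ^ 2) • ∑ j ∈ s, d j‖ := by
          refine CStarAlgebra.norm_le_norm_of_nonneg_of_le
            (Finset.sum_nonneg fun j _ => star_mul_self_nonneg _) ?_
          rw [Finset.smul_sum]
          refine Finset.sum_le_sum fun j _ => ?_
          have h3 := CStarAlgebra.star_left_conjugate_le_norm_smul (a := d j)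
            (b := star (y j) * y j) (.star_mul_self _)
          rw [CStarRing.norm_star_mul_self, (hd j).isSelfAdjoint.star_eq] at h3
          calc _ = d j * (star (y j) * y j) * d j := by
                rw [star_mul, (hd j).isSelfAdjoint.star_eq]; simp only [mul_assoc]
            _ ≤ _ := h3
            _ ≤ (‖y j‖ * ‖y j‖) • d j :=
                smul_le_smul_of_nonneg_left (mul_self_le_self (hd j) (hd1 j)) (by positivity)
            _ ≤ K ^ 2 • d j :=
                smul_le_smul_of_nonneg_right (by
                  rw [← sq]; exact pow_le_pow_left₀ (norm_nonneg _) (hy j) 2) (hd j)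
      _ = _ := by rw [norm_smul, Real.norm_of_nonneg (by positivity)]
  calc ‖∑ j ∈ s, c j * y j * d j‖ = ‖∑ j ∈ s, c j * (y j * d j)‖ := by simp only [mul_assoc]
    _ ≤ √‖∑ j ∈ s, c j‖ * √(K ^ 2 * ‖∑ j ∈ s, d j‖) := by
        refine (norm_sum_mul_le s _ _).trans ?_
        gcongr
    _ = _ := by rw [Real.sqrt_mul (by positivity), Real.sqrt_sq hK]; ring

/-- An increasing sequence of positive contractions whose `n`-th member acts as a unit, up to
`2⁻ⁿ`, on the finite sets `G (i m) (e m)` determined by the earlier members. The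
strictly increasing `i` allows these sets to run through a given sequence as well. -/
theorem exists_seq_approximateUnit (G : ℕ → A → Finset A) :
    ∃ (i : ℕ → ℕ) (e : ℕ → A), StrictMono i ∧ Monotone e ∧ (∀ n, 0 ≤ e n) ∧ (∀ n, ‖e n‖ ≤ 1) ∧
      ∀ m n, m < n → ∀ a ∈ G (i m) (e m),
        ‖e n * a - a‖ ≤ 2⁻¹ ^ n ∧ ‖a * e n - a‖ ≤ 2⁻¹ ^ n := by
  obtain ⟨f, hf, hf'⟩ := exists_seq_of_forall_finset_exists
    (fun z : ℕ × A => 0 ≤ z.2 ∧ ‖z.2‖ < 1)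
    (fun z w => z.1 < w.1 ∧ z.2 ≤ w.2 ∧ ∀ a ∈ G z.1 z.2,
      ‖w.2 * a - a‖ < 2⁻¹ ^ w.1 ∧ ‖a * w.2 - a‖ < 2⁻¹ ^ w.1) (by
    intro s hs
    obtain ⟨N, hN⟩ : ∃ N, ∀ z ∈ s, z.1 < N :=
      ⟨s.sup Prod.fst + 1, fun z hz => Nat.lt_succ_of_le (Finset.le_sup (f := Prod.fst) hz)⟩
    have hu := CStarAlgebra.increasingApproximateUnit A
    have hpos : (0 : ℝ) < 2⁻¹ ^ N := by positivity
    have hev : ∀ᶠ e in CStarAlgebra.approximateUnit A, ∀ z ∈ s, z.2 ≤ e ∧ ∀ a ∈ G z.1 z.2,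
        ‖e * a - a‖ < 2⁻¹ ^ N ∧ ‖a * e - a‖ < 2⁻¹ ^ N := by
      refine (Filter.eventually_all_finset s).mpr fun z hz => ?_
      refine ((CStarAlgebra.hasBasis_approximateUnit A).eventually_iff.mpr
        ⟨z.2, hs z hz, fun e he => he.1⟩).and ((Filter.eventually_all_finset _).mpr fun a _ => ?_)
      have h1 := (hu.tendsto_mul_right a).eventually (Metric.ball_mem_nhds a hpos)
      have h2 := (hu.tendsto_mul_left a).eventually (Metric.ball_mem_nhds a hpos)
      filter_upwards [h1, h2] with e he1 he2
      rw [dist_eq_norm] at he1 he2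
      exact ⟨he1, he2⟩
    obtain ⟨e, he, hsub⟩ := (CStarAlgebra.hasBasis_approximateUnit A).eventually_iff.mp hev
    have hmem := hsub (⟨le_refl e, by simpa using he.2.le⟩ : e ∈ {y | e ≤ y} ∩ _)
    exact ⟨(N, e), he, fun z hz => ⟨hN z hz, (hmem z hz).1, (hmem z hz).2⟩⟩)
  have hmono : StrictMono fun n => (f n).1 := fun m n hmn => (hf' m n hmn).1
  refine ⟨fun n => (f n).1, fun n => (f n).2, hmono,
    monotone_nat_of_le_succ fun n => (hf' n (n + 1) n.lt_succ_self).2.1, fun n => (hf n).1,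
    fun n => (hf n).2.le, fun m n hmn a ha => ?_⟩
  have h1 : (2⁻¹ : ℝ) ^ (f n).1 ≤ 2⁻¹ ^ n :=
    pow_le_pow_of_le_one (by norm_num) (by norm_num) (hmono.id_le n)
  exact ⟨((hf' m n hmn).2.2 a ha).1.le.trans h1, ((hf' m n hmn).2.2 a ha).2.le.trans h1⟩

end Sums

section Strict

variable {A : Type*} [NonUnitalCStarAlgebra A]

theorem tendsto_mul_of_approximateUnit {u e : ℕ → A} (he : ∀ n, ‖e n‖ ≤ 1) {a : A}
    (hu : Tendsto (fun m => u m * a) atTop (𝓝 a))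
    (heu : ∀ m, Tendsto (fun n => e n * u m) atTop (𝓝 (u m))) :
    Tendsto (fun n => e n * a) atTop (𝓝 a) := by
  rw [Metric.tendsto_atTop] at hu ⊢
  intro ε hε
  obtain ⟨m, hm⟩ := hu (ε / 3) (by positivity)
  have hm := hm m le_rfl
  have h1 := ((heu m).mul_const a)
  rw [Metric.tendsto_atTop] at h1
  obtain ⟨N, hN⟩ := h1 (ε / 3) (by positivity)
  refine ⟨N, fun n hn => ?_⟩
  have h2 : dist (e n * a) (e n * u m * a) ≤ dist (u m * a) a := by
    rw [dist_comm, dist_eq_norm, dist_eq_norm, mul_assoc, ← mul_sub]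
    exact (norm_mul_le _ _).trans (mul_le_of_le_one_left (norm_nonneg _) (he n))
  calc dist (e n * a) a ≤ dist (e n * a) (e n * u m * a) + dist (e n * u m * a) (u m * a)
        + dist (u m * a) a := dist_triangle4 _ _ _ _
    _ < ε := by linarith [hN n hn]

/-- For bounded sequences, strict Cauchyness may be tested on an approximate unit. -/
theorem cauchySeq_mul_of_approximateUnit {S e : ℕ → A} {R : ℝ} (hS : ∀ n, ‖S n‖ ≤ R) {a : A}
    (he : Tendsto (fun m => e m * a) atTop (𝓝 a))
    (hSe : ∀ m, CauchySeq fun n => S n * e m) : CauchySeq fun n => S n * a := by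
  have hR : 0 ≤ R := (norm_nonneg _).trans (hS 0)
  rw [Metric.cauchySeq_iff']
  intro ε hε
  have hδ : 0 < ε / (3 * (R + 1)) := by positivity
  obtain ⟨m, hm⟩ := Metric.tendsto_atTop.mp he _ hδ
  have hm := hm m le_rfl
  obtain ⟨l, hl⟩ := cauchySeq_tendsto_of_complete (hSe m)
  obtain ⟨N, hN⟩ := Metric.cauchySeq_iff'.mp (hl.mul_const a).cauchySeq (ε / 3) (by positivity)
  have h2 : ∀ n, dist (S n * a) (S n * e m * a) < ε / 3 := fun n => by
    rw [dist_comm, dist_eq_norm, mul_assoc, ← mul_sub]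
    rw [dist_eq_norm] at hm
    calc _ ≤ ‖S n‖ * ‖e m * a - a‖ := norm_mul_le _ _
      _ ≤ R * ‖e m * a - a‖ := by gcongr; exact hS n
      _ ≤ (R + 1) * ‖e m * a - a‖ := by gcongr; linarith
      _ < (R + 1) * (ε / (3 * (R + 1))) := by gcongr
      _ = ε / 3 := by field_simp
  refine ⟨N, fun n hn => ?_⟩
  calc dist (S n * a) (S N * a) ≤ dist (S n * a) (S n * e m * a)
        + dist (S n * e m * a) (S N * e m * a) + dist (S N * e m * a) (S N * a) :=
        dist_triangle4 _ _ _ _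
    _ < ε := by
      have h3 := h2 N
      rw [dist_comm] at h3
      linarith [h2 n, hN n hn]

/-- A sequence that is Cauchy for the strict topology converges strictly to a multiplier. -/
theorem exists_multiplier_of_cauchySeq {S : ℕ → A} (hl : ∀ a, CauchySeq fun n => S n * a)
    (hr : ∀ a, CauchySeq fun n => a * S n) :
    ∃ m : 𝓜(ℂ, A), ∀ a, Tendsto (fun n => S n * a) atTop (𝓝 (m.fst a)) := by
  choose l hl using fun a => cauchySeq_tendsto_of_complete (hl a)
  choose r hr using fun a => cauchySeq_tendsto_of_complete (hr a)
  refine ⟨DoubleCentralizer.ofCentral l r fun a b => ?_, hl⟩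
  refine tendsto_nhds_unique ((hr a).mul_const b) ?_
  simp only [mul_assoc]
  exact (hl b).const_mul a

end Strict

namespace DoubleCentralizer

/-- The noncommutative Tietze extension theorem: multipliers lift along a quotient map of a
σ-unital C⋆-algebra.

For a suitable increasing approximate unit `e`, a multiplier `x` of the quotient is almost
block-diagonal with respect to the increments `d j = e (j + 2) - e (j + 1)`: up to a norm-convergent
sum in `B` it is the strict sum of the `c j * x * d j` with `c j = e (j + 3) - e j`. Each summand
lifts to `E` with control of the norm, the sum of the lifts converges strictly, and the error is in
`B = π(E)`. -/
theorem map_surjective {E B : Type*} [NonUnitalCStarAlgebra E] [NonUnitalCStarAlgebra B]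
    {π : E →⋆ₙₐ[ℂ] B} (hπ : Function.Surjective π) (hE : IsSigmaUnital E) :
    Function.Surjective (map hπ) := by
  classical
  let _ := CStarAlgebra.spectralOrder E
  have := CStarAlgebra.spectralOrderedRing E
  intro x
  obtain ⟨u, -, -, hul, -⟩ := hE
  obtain ⟨K, hK0, hK⟩ := exists_lift_norm_le π hπ
  have hπn : ∀ a, ‖π a‖ ≤ ‖a‖ := NonUnitalStarAlgHom.norm_apply_le π
  have hπc : Continuous π := AddMonoidHomClass.continuous_of_bound π 1 (by simpa using hπn)
  choose W hW using fun a => hπ (x.fst (π a))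
  choose V hV using fun a => hπ (x.snd (π a))
  obtain ⟨i, e, hi, hmono, he0, he1, hG⟩ :=
    exists_seq_approximateUnit fun k a => ({u k, a, W a, V a} : Finset E)
  have heu : ∀ m n, m < n → ‖e n * u (i m) - u (i m)‖ ≤ 2⁻¹ ^ n :=
    fun m n h => (hG m n h _ (by simp)).1
  have hee : ∀ m n, m < n → ‖e n * e m - e m‖ ≤ 2⁻¹ ^ n :=
    fun m n h => (hG m n h _ (by simp)).1
  have hex : ∀ m n, m < n → ‖π (e n) * x.fst (π (e m)) - x.fst (π (e m))‖ ≤ 2⁻¹ ^ n :=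
    fun m n h => by
      rw [← hW, ← map_mul, ← map_sub]
      exact (hπn _).trans (hG m n h _ (by simp)).1
  have hxe : ∀ m n, m < n → ‖x.snd (π (e m)) * π (e n) - x.snd (π (e m))‖ ≤ 2⁻¹ ^ n :=
    fun m n h => by
      rw [← hV, ← map_mul, ← map_sub]
      exact (hπn _).trans (hG m n h _ (by simp)).2
  have hpow : Tendsto (fun n : ℕ => (2⁻¹ : ℝ) ^ n) atTop (𝓝 0) :=
    tendsto_pow_atTop_nhds_zero_of_lt_one (by norm_num) (by norm_num)
  -- `e` is an approximate unit
  have hel : ∀ a, Tendsto (fun n => e n * a) atTop (𝓝 a) := fun a =>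
    tendsto_mul_of_approximateUnit he1 (u := fun m => u (i m))
      ((hul a).comp hi.tendsto_atTop) fun m => by
        rw [tendsto_iff_norm_sub_tendsto_zero]
        refine squeeze_zero' (Eventually.of_forall fun _ => norm_nonneg _) ?_ hpow
        filter_upwards [eventually_gt_atTop m] with n hn using heu m n hn
  -- `c j` is wider than `d j` by one step on each side, as `x` is only almost block-diagonal
  set c : ℕ → E := fun j => e (j + 3) - e j with hc
  set d : ℕ → E := fun j => e (j + 2) - e (j + 1) with hd
  have hdiff : ∀ m n, m ≤ n → 0 ≤ e n - e m ∧ ‖e n - e m‖ ≤ 1 := fun m n h => by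
    have h0 : 0 ≤ e n - e m := sub_nonneg.mpr (hmono h)
    exact ⟨h0, (CStarAlgebra.norm_le_norm_of_nonneg_of_le h0
      (sub_le_self _ (he0 m))).trans (he1 n)⟩
  have hc0 : ∀ j, 0 ≤ c j := fun j => (hdiff j (j + 3) (by omega)).1
  have hc1 : ∀ j, ‖c j‖ ≤ 1 := fun j => (hdiff j (j + 3) (by omega)).2
  have hd0 : ∀ j, 0 ≤ d j := fun j => (hdiff (j + 1) (j + 2) (by omega)).1
  have hd1 : ∀ j, ‖d j‖ ≤ 1 := fun j => (hdiff (j + 1) (j + 2) (by omega)).2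
  have hdsum : ∀ N, ∑ j ∈ Finset.range N, d j = e (N + 1) - e 1 := fun N =>
    Finset.sum_range_sub (fun j => e (j + 1)) N
  have hcsum : ∀ N, ‖∑ j ∈ Finset.range N, c j‖ ≤ 3 := fun N => by
    have h1 : ∑ j ∈ Finset.range N, c j
        = (e (N + 2) - e 2) + (e (N + 1) - e 1) + (e N - e 0) := by
      rw [← Finset.sum_range_sub (fun j => e (j + 2)) N,
        ← Finset.sum_range_sub (fun j => e (j + 1)) N,
        ← Finset.sum_range_sub e N, ← Finset.sum_add_distrib, ← Finset.sum_add_distrib]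
      refine Finset.sum_congr rfl fun j _ => ?_
      change e (j + 3) - e j
        = (e (j + 3) - e (j + 2)) + (e (j + 2) - e (j + 1)) + (e (j + 1) - e j)
      abel
    rw [h1]
    refine norm_add₃_le.trans ?_
    linarith [(hdiff 2 (N + 2) (by omega)).2, (hdiff 1 (N + 1) (by omega)).2,
      (hdiff 0 N (by omega)).2]
  choose y hy hyn using fun j => hK (x.fst (π (e (j + 3))))
  have hyb : ∀ j, ‖y j‖ ≤ K * ‖x‖ := fun j => by
    refine (hyn j).trans ?_
    gcongr
    calc _ ≤ ‖x‖ * ‖π (e (j + 3))‖ := norm_fst_apply_le x _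
      _ ≤ ‖x‖ * 1 := by gcongr; exact (hπn _).trans (he1 _)
      _ = ‖x‖ := mul_one _
  have hK' : 0 ≤ K * ‖x‖ := by positivity
  set S : ℕ → E := fun N => ∑ j ∈ Finset.range N, c j * y j * d j with hS
  have hSb : ∀ N, ‖S N‖ ≤ K * ‖x‖ * (√3 * √1) := fun N => by
    refine (norm_sum_mul_mul_le _ hK' hc0 hc1 hd0 hd1 hyb).trans ?_
    gcongr
    · exact hcsum N
    · rw [hdsum]
      exact (hdiff 1 (N + 1) (by omega)).2
  have hSstar : ∀ N, ‖star (S N)‖ ≤ K * ‖x‖ * (√3 * √1) := fun N => by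
    rw [norm_star]; exact hSb N
  have hsumm : ∀ C : ℝ, Summable fun j : ℕ => C * (2⁻¹ : ℝ) ^ j := fun C =>
    (summable_geometric_of_lt_one (by norm_num) (by norm_num)).mul_left C
  have hhalf : ∀ j k : ℕ, (2⁻¹ : ℝ) ^ (j + k + 1) ≤ 2⁻¹ ^ j * 2⁻¹ := fun j k => by
    rw [← pow_succ]
    exact pow_le_pow_of_le_one (by norm_num) (by norm_num) (by omega)
  -- the strict sum of the lifted blocks
  have hSr : ∀ m, CauchySeq fun N => S N * e m := fun m => by
    simp only [hS, Finset.sum_mul]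
    have : Summable fun j => c j * y j * d j * e m := by
      refine Summable.of_norm_bounded_eventually_nat (hsumm (K * ‖x‖)) ?_
      filter_upwards [eventually_ge_atTop m] with j hj
      have h1 : ‖d j * e m‖ ≤ 2⁻¹ ^ j := by
        have : d j * e m = (e (j + 2) * e m - e m) - (e (j + 1) * e m - e m) := by
          simp only [hd, sub_mul]; abel
        rw [this]
        refine (norm_sub_le _ _).trans ?_
        linarith [hee m (j + 2) (by omega), hee m (j + 1) (by omega), hhalf j 1, hhalf j 0]
      calc ‖c j * y j * d j * e m‖ = ‖c j * y j * (d j * e m)‖ := by rw [mul_assoc (c j * y j)]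
        _ ≤ ‖c j‖ * ‖y j‖ * ‖d j * e m‖ := norm_mul₃_le
        _ ≤ 1 * (K * ‖x‖) * 2⁻¹ ^ j := by gcongr; exacts [hc1 j, hyb j]
        _ = _ := by ring
    exact this.hasSum.tendsto_sum_nat.cauchySeq
  have hSl : ∀ m, CauchySeq fun N => star (S N) * e m := fun m => by
    have : Summable fun j => star (c j * y j * d j) * e m := by
      refine Summable.of_norm_bounded_eventually_nat (hsumm (2 * (K * ‖x‖))) ?_
      filter_upwards [eventually_gt_atTop m] with j hj
      have h1 : ‖c j * e m‖ ≤ 2 * 2⁻¹ ^ j := by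
        have : c j * e m = (e (j + 3) * e m - e m) - (e j * e m - e m) := by
          simp only [hc, sub_mul]; abel
        rw [this]
        refine (norm_sub_le _ _).trans ?_
        linarith [hee m (j + 3) (by omega), hee m j hj, hhalf j 2,
          pow_pos (by norm_num : (0 : ℝ) < 2⁻¹) j]
      calc ‖star (c j * y j * d j) * e m‖ = ‖star (d j) * star (y j) * (c j * e m)‖ := by
            rw [star_mul, star_mul, (hc0 j).isSelfAdjoint.star_eq]; simp only [mul_assoc]
        _ ≤ ‖star (d j)‖ * ‖star (y j)‖ * ‖c j * e m‖ := norm_mul₃_le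
        _ ≤ 1 * (K * ‖x‖) * (2 * 2⁻¹ ^ j) := by
            rw [norm_star, norm_star]; gcongr; exacts [hd1 j, hyb j]
        _ = _ := by ring
    have h2 := this.hasSum.tendsto_sum_nat.cauchySeq
    simpa only [hS, star_sum, Finset.sum_mul] using h2
  obtain ⟨m, hm⟩ := exists_multiplier_of_cauchySeq
    (fun a => cauchySeq_mul_of_approximateUnit hSb (hel a) hSr) (fun a => by
      have h1 := cauchySeq_mul_of_approximateUnit hSstar (hel (star a)) hSl
      obtain ⟨l, hl⟩ := cauchySeq_tendsto_of_complete h1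
      have h2 := ((continuous_star.tendsto l).comp hl).cauchySeq
      simpa only [Function.comp_def, star_mul, star_star] using h2)
  -- the error made by cutting `x` down to blocks
  set t : ℕ → B := fun j => π (c j * y j * d j) - x.fst (π (d j)) with ht
  have htn : ∀ j, ‖t j‖ ≤ (‖x‖ + 2) * 2⁻¹ ^ j := fun j => by
    have h1 : t j = π (c j) * x.fst (π (e (j + 3) * d j - d j))
        + ((π (e (j + 3)) * x.fst (π (d j)) - x.fst (π (d j)))
        - ((x.snd (π (e j)) * π (e (j + 2)) - x.snd (π (e j)))
          - (x.snd (π (e j)) * π (e (j + 1)) - x.snd (π (e j))))) := by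
      have h2 : x.snd (π (e j)) * π (e (j + 2)) - x.snd (π (e j)) * π (e (j + 1))
          = π (e j) * x.fst (π (d j)) := by
        rw [← mul_sub, ← map_sub, x.central]
      have h3 : π (c j) = π (e (j + 3)) - π (e j) := map_sub π _ _
      rw [sub_sub_sub_cancel_right, h2, map_sub π (e (j + 3) * d j), map_mul π (e (j + 3)),
        map_sub x.fst, fst_mul, ← hy, mul_sub, ht]
      simp only [map_mul]
      rw [h3]
      noncomm_ring
    have h4 : ‖e (j + 3) * d j - d j‖ ≤ 2⁻¹ ^ j := by
      have : e (j + 3) * d j - d j = (e (j + 3) * e (j + 2) - e (j + 2))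
          - (e (j + 3) * e (j + 1) - e (j + 1)) := by
        simp only [hd, mul_sub]; abel
      rw [this]
      refine (norm_sub_le _ _).trans ?_
      linarith [hee (j + 2) (j + 3) (by omega), hee (j + 1) (j + 3) (by omega), hhalf j 2]
    have h5 : ‖π (c j) * x.fst (π (e (j + 3) * d j - d j))‖ ≤ ‖x‖ * 2⁻¹ ^ j := by
      calc _ ≤ ‖π (c j)‖ * ‖x.fst (π (e (j + 3) * d j - d j))‖ := norm_mul_le _ _
        _ ≤ 1 * (‖x‖ * ‖π (e (j + 3) * d j - d j)‖) := by
          gcongr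
          · exact (hπn _).trans (hc1 j)
          · exact norm_fst_apply_le x _
        _ ≤ 1 * (‖x‖ * 2⁻¹ ^ j) := by gcongr; exact (hπn _).trans h4
        _ = _ := one_mul _
    have h6 : ‖π (e (j + 3)) * x.fst (π (d j)) - x.fst (π (d j))‖ ≤ 2⁻¹ ^ j := by
      have : π (e (j + 3)) * x.fst (π (d j)) - x.fst (π (d j))
          = (π (e (j + 3)) * x.fst (π (e (j + 2))) - x.fst (π (e (j + 2))))
          - (π (e (j + 3)) * x.fst (π (e (j + 1))) - x.fst (π (e (j + 1)))) := by
        simp only [hd, map_sub, mul_sub]; abel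
      rw [this]
      refine (norm_sub_le _ _).trans ?_
      linarith [hex (j + 2) (j + 3) (by omega), hex (j + 1) (j + 3) (by omega), hhalf j 2]
    rw [h1]
    refine (norm_add_le _ _).trans ?_
    have h7 := norm_sub_le (π (e (j + 3)) * x.fst (π (d j)) - x.fst (π (d j)))
      ((x.snd (π (e j)) * π (e (j + 2)) - x.snd (π (e j)))
          - (x.snd (π (e j)) * π (e (j + 1)) - x.snd (π (e j))))
    have h8 := norm_sub_le (x.snd (π (e j)) * π (e (j + 2)) - x.snd (π (e j)))
      (x.snd (π (e j)) * π (e (j + 1)) - x.snd (π (e j)))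
    linarith [hxe j (j + 2) (by omega), hxe j (j + 1) (by omega), hhalf j 1, hhalf j 0]
  have hts : Summable t := Summable.of_norm_bounded (hsumm _) htn
  have hmap : map hπ m + ((x.fst (π (e 1)) : B) : 𝓜(ℂ, B)) = x + ((∑' j, t j : B) : 𝓜(ℂ, B)) := by
    refine ext_of_fst_map hπ fun a => ?_
    change (map hπ m).fst (π a) + x.fst (π (e 1)) * π a = x.fst (π a) + (∑' j, t j) * π a
    rw [map_fst]
    have h1 : Tendsto (fun N => π (S N * a) + x.fst (π (e 1)) * π a) atTop
        (𝓝 (π (m.fst a) + x.fst (π (e 1)) * π a)) :=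
      ((hπc.tendsto _).comp (hm a)).add_const _
    refine tendsto_nhds_unique h1 ?_
    have h2 : ∀ N, π (S N * a) + x.fst (π (e 1)) * π a
        = x.fst (π (e (N + 1) * a)) + (∑ j ∈ Finset.range N, t j) * π a := fun N => by
      have h3 : π (S N) = (∑ j ∈ Finset.range N, t j)
          + (x.fst (π (e (N + 1))) - x.fst (π (e 1))) := by
        rw [← map_sub, ← map_sub, ← hdsum, map_sum, map_sum, map_sum, ← Finset.sum_add_distrib]
        exact Finset.sum_congr rfl fun j _ => by rw [ht, sub_add_cancel]
      rw [map_mul, map_mul, h3, fst_mul, add_mul, sub_mul]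
      abel
    simp only [h2]
    refine Tendsto.add ?_ (hts.hasSum.tendsto_sum_nat.mul_const _)
    exact ((x.fst.continuous.comp hπc).tendsto _).comp
      ((tendsto_add_atTop_iff_nat 1).mpr (hel a))
  obtain ⟨b, hb⟩ := hπ (∑' j, t j - x.fst (π (e 1)))
  refine ⟨m - b, ?_⟩
  have hcoe : ((∑' j, t j - x.fst (π (e 1)) : B) : 𝓜(ℂ, B))
      = ((∑' j, t j : B) : 𝓜(ℂ, B)) - ((x.fst (π (e 1)) : B) : 𝓜(ℂ, B)) :=
    map_sub (coeHom (𝕜 := ℂ) (A := B)) _ _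
  rw [map_sub, map_coe, hb, hcoe, ← sub_add, sub_add_eq_add_sub, hmap, add_sub_cancel_right]

end DoubleCentralizer

/-! ### Corona algebras of extensions -/

namespace Corona

/-- The quotient map `M(A) → M(A)/A` as a ⋆-homomorphism. -/
noncomputable def mkStar (A : Type*) [NonUnitalCStarAlgebra A] : 𝓜(ℂ, A) →⋆ₐ[ℂ] Corona A :=
  { mk A with map_star' := fun x => (star_mk x).symm }

theorem mk_eq_zero_iff {A : Type*} [NonUnitalCStarAlgebra A] {x : 𝓜(ℂ, A)} :
    mk A x = 0 ↔ ∃ a : A, (a : 𝓜(ℂ, A)) = x := by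
  rw [← map_zero (mk A), mk_eq_mk_iff, sub_zero, mem_multiplierIdeal]

theorem mk_coe {A : Type*} [NonUnitalCStarAlgebra A] (a : A) : mk A (a : 𝓜(ℂ, A)) = 0 :=
  mk_eq_zero_iff.mpr ⟨a, rfl⟩

variable {E B : Type*} [NonUnitalCStarAlgebra E] [NonUnitalCStarAlgebra B] {π : E →⋆ₙₐ[ℂ] B}
  (hπ : Function.Surjective π)

/-- The ⋆-homomorphism of corona algebras induced by a surjection `E → B`. -/
noncomputable def map : Corona E →⋆ₐ[ℂ] Corona B :=
  { Ideal.Quotient.liftₐ (multiplierIdeal E)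
      ((mk B).comp (DoubleCentralizer.map hπ : 𝓜(ℂ, E) →ₐ[ℂ] 𝓜(ℂ, B))) (by
        rintro _ ⟨e, rfl⟩
        change mk B (DoubleCentralizer.map hπ (e : 𝓜(ℂ, E))) = 0
        rw [DoubleCentralizer.map_coe, mk_coe]) with
    map_star' := fun x => by
      obtain ⟨x, rfl⟩ := mk_surjective x
      change mk B (DoubleCentralizer.map hπ (star x)) = star (mk B (DoubleCentralizer.map hπ x))
      rw [star_mk, map_star] }

theorem map_mk (x : 𝓜(ℂ, E)) : map hπ (mk E x) = mk B (DoubleCentralizer.map hπ x) := rfl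

theorem map_surjective (hE : IsSigmaUnital E) : Function.Surjective (map hπ) := by
  intro y
  obtain ⟨y, rfl⟩ := mk_surjective y
  obtain ⟨x, rfl⟩ := DoubleCentralizer.map_surjective hπ hE y
  exact ⟨mk E x, map_mk hπ x⟩

end Corona

/-! ### The kernel of the map of multiplier algebras -/

namespace DoubleCentralizer

section Kernel

variable {E B : Type*} [NonUnitalCStarAlgebra E] [NonUnitalCStarAlgebra B] {π : E →⋆ₙₐ[ℂ] B}
  (hπ : Function.Surjective π)

/-- The kernel of `M(E) → M(B)`, as a C⋆-subalgebra of `M(E)`. -/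
noncomputable def kernel : NonUnitalStarSubalgebra ℂ 𝓜(ℂ, E) where
  carrier := {m | map hπ m = 0}
  add_mem' {m n} (hm : map hπ m = 0) (hn : map hπ n = 0) := by
    change map hπ (m + n) = 0
    rw [map_add, hm, hn, add_zero]
  zero_mem' := map_zero (map hπ)
  mul_mem' {m n} (hm : map hπ m = 0) _ := by
    change map hπ (m * n) = 0
    rw [map_mul, hm, zero_mul]
  smul_mem' c m (hm : map hπ m = 0) := by
    change map hπ (c • m) = 0
    rw [map_smul, hm, smul_zero]
  star_mem' {m} (hm : map hπ m = 0) := by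
    change map hπ (star m) = 0
    rw [map_star, hm, star_zero]

open CStarAlgebra in
instance isClosed_kernel : IsClosed (kernel hπ : Set 𝓜(ℂ, E)) :=
  isClosed_singleton.preimage (map_continuous (map hπ))

end Kernel

variable {A E B : Type*} [NonUnitalCStarAlgebra A] [NonUnitalCStarAlgebra E]
  [NonUnitalCStarAlgebra B] {ι : A →⋆ₙₐ[ℂ] E} {π : E →⋆ₙₐ[ℂ] B} (hext : IsCStarExtension ι π)
include hext

/-- An element of the kernel of `M(E) → M(B)` lies in `E` if and only if its restriction to `A` lies
in `A`. -/
theorem exists_coe_eq_restrict_iff {m : 𝓜(ℂ, E)} (hm : map hext.surjective m = 0) :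
    (∃ a : A, (a : 𝓜(ℂ, A)) = restrict hext m) ↔ ∃ e : E, (e : 𝓜(ℂ, E)) = m := by
  constructor
  · rintro ⟨a, ha⟩
    have h0 : π (ι a) = 0 := (hext.exact _).mpr ⟨a, rfl⟩
    refine ⟨ι a, (sub_eq_zero.mp (eq_zero_of_restrict_eq_zero hext ?_ ?_)).symm⟩
    · rw [map_sub, hm, map_coe, h0, zero_sub, neg_eq_zero]
      exact map_zero (coeHom (𝕜 := ℂ) (A := B))
    · rw [map_sub, restrict_coe, ha, sub_self]
  · rintro ⟨e, rfl⟩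
    rw [map_coe, ← norm_eq_zero, norm_coe_multiplier, norm_eq_zero] at hm
    obtain ⟨a, rfl⟩ := (hext.exact _).mp hm
    exact ⟨a, (restrict_coe hext a).symm⟩

theorem realRank_le_add_one (hE : IsSigmaUnital E) (hA : realRank 𝓜(ℂ, A) = 0) :
    realRank 𝓜(ℂ, E) ≤ realRank 𝓜(ℂ, B) + 1 := by
  let i : kernel hext.surjective →⋆ₙₐ[ℂ] 𝓜(ℂ, E) := NonUnitalStarSubalgebraClass.subtype _
  refine realRank_le_add_one_of_extension (map hext.surjective) (map_surjective _ hE) i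
    ((restrict hext).comp i) (fun x => ?_) (fun d => ?_) (fun x y c => ?_) hA
  · refine ⟨fun h => eq_zero_of_restrict_eq_zero hext x.2 h, fun h => ?_⟩
    rw [NonUnitalStarAlgHom.comp_apply, h, map_zero]
  · exact ⟨fun h => ⟨⟨d, h⟩, rfl⟩, by rintro ⟨x, rfl⟩; exact x.2⟩
  · obtain ⟨m, hm, hm'⟩ := exists_restrict_eq_mul_mul hext x.2 y.2 c
    exact ⟨⟨m, hm⟩, hm'⟩

theorem realRank_corona_le_add_one (hE : IsSigmaUnital E) (hA : realRank (Corona A) = 0) :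
    realRank (Corona E) ≤ realRank (Corona B) + 1 := by
  let i : kernel hext.surjective →⋆ₙₐ[ℂ] 𝓜(ℂ, E) := NonUnitalStarSubalgebraClass.subtype _
  refine realRank_le_add_one_of_extension (Corona.map hext.surjective) (Corona.map_surjective _ hE)
    ((Corona.mkStar E).toNonUnitalStarAlgHom.comp i)
    ((Corona.mkStar A).toNonUnitalStarAlgHom.comp ((restrict hext).comp i))
    (fun x => ?_) (fun d => ?_) (fun x y c => ?_) hA
  · change Corona.mk A (restrict hext x) = 0 ↔ Corona.mk E x = 0
    rw [Corona.mk_eq_zero_iff, Corona.mk_eq_zero_iff]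
    exact exists_coe_eq_restrict_iff hext x.2
  · obtain ⟨d, rfl⟩ := Corona.mk_surjective d
    rw [Corona.map_mk, Corona.mk_eq_zero_iff]
    constructor
    · rintro ⟨b, hb⟩
      obtain ⟨e, rfl⟩ := hext.surjective b
      refine ⟨⟨d - e, ?_⟩, ?_⟩
      · change map hext.surjective (d - e) = 0
        rw [map_sub, map_coe, hb, sub_self]
      · change Corona.mk E (d - e) = Corona.mk E d
        rw [map_sub, Corona.mk_coe, sub_zero]
    · rintro ⟨x, hx⟩
      change Corona.mk E x = Corona.mk E d at hx
      rw [← Corona.mk_eq_zero_iff, ← Corona.map_mk, ← hx, Corona.map_mk,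
        (show map hext.surjective x = 0 from x.2), map_zero]
  · obtain ⟨c, rfl⟩ := Corona.mk_surjective c
    obtain ⟨m, hm, hm'⟩ := exists_restrict_eq_mul_mul hext x.2 y.2 c
    refine ⟨⟨m, hm⟩, ?_⟩
    change Corona.mk A (restrict hext m) = Corona.mk A (restrict hext x) * Corona.mk A c *
      Corona.mk A (restrict hext y)
    rw [hm', map_mul, map_mul]

end DoubleCentralizer

theorem mainTheorem10 {A E B : Type*} [NonUnitalCStarAlgebra A] [NonUnitalCStarAlgebra E]
    [NonUnitalCStarAlgebra B] (ι : A →⋆ₙₐ[ℂ] E) (π : E →⋆ₙₐ[ℂ] B) (hext : IsCStarExtension ι π)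
    (hE : IsSigmaUnital E) :
    (realRank 𝓜(ℂ, A) = 0 →
      realRank 𝓜(ℂ, B) ≤ realRank 𝓜(ℂ, E) ∧ realRank 𝓜(ℂ, E) ≤ realRank 𝓜(ℂ, B) + 1) ∧
    (realRank (Corona A) = 0 →
      realRank (Corona B) ≤ realRank (Corona E) ∧
        realRank (Corona E) ≤ realRank (Corona B) + 1) :=
  ⟨fun hA => ⟨realRank_le_of_surjective _ (DoubleCentralizer.map_surjective hext.surjective hE),
      DoubleCentralizer.realRank_le_add_one hext hE hA⟩,
    fun hA => ⟨realRank_le_of_surjective _ (Corona.map_surjective hext.surjective hE),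
      DoubleCentralizer.realRank_corona_le_add_one hext hE hA⟩⟩
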